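/- A diagram of a knot is called \emph{matched} if its set of crossings can be partitioned into pairs such that the two crossings of each pair are joined by two edges of the diagram that bound a bigon face, and along this bigon two strands, which run in opposite directions, make one full twist around each other (the two crossings have the same sign, and each of the two strands passes over the other at exactly one of them). A knot in $\mathbb{R}^3$ is called \emph{bipartite} if it has a matched diagram, i.e. if some diagram of it (equivalently, some diagram related to a given one by planar isotopy and Reidemeister moves) is matched. Then none of the following knots of Rolfsen's table (Conway's notation in parentheses), in either chirality, is bipartite: $9_{35}$ ($3,3,3$), $9_{37}$ ($3,21,21$), $9_{41}$ ($20{:}20{:}20$), $9_{46}$ ($3,3,21-$, the pretzel knot with parameters $(3,3,-3)$), $9_{47}$ ($8^*{-}20$), $9_{48}$ ($21,21,21-$), $9_{49}$ ($-20{:}{-}20{:}{-}20$), $10_{74}$ ($3,3,21+$), $10_{75}$ ($21,21,21+$), $10_{103}$ ($30{:}2{:}2$), $10_{155}$ ($-3{:}2{:}2$) and $10_{157}$ ($-3{:}20{:}20$). -/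

import Mathlib

/-!
Knots are handled through their diagrams: an oriented knot diagram on the oriented sphere is
recorded by its signed Gauss word, and two diagrams represent the same knot when they are related
by a finite sequence of Reidemeister moves through such diagrams.
-/

/-- One passage of the knot through a crossing: the name of the crossing, whether the knot passes
over or under, and whether the crossing is positive (right-handed). -/
structure Pass where
  label : ℕ
  upper : Bool
  pos : Bool
  deriving DecidableEq

namespace Pass

/-- The other passage through the same crossing. -/
def flip (x : Pass) : Pass := ⟨x.label, !x.upper, x.pos⟩

/-- The same passage after all crossings have been switched. -/
def mirror (x : Pass) : Pass := ⟨x.label, !x.upper, !x.pos⟩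

/-- The same passage after a renaming of the crossings. -/
def relabel (σ : Equiv.Perm ℕ) (x : Pass) : Pass := ⟨σ x.label, x.upper, x.pos⟩

/-- Seen from the passage `x`, the other strand at this crossing runs from right to left.
(At a positive crossing the direction of the lower strand is obtained from that of the upper
strand by a counterclockwise rotation.) -/
def otherToLeft (x : Pass) : Bool := x.upper == x.pos

end Pass

/-- The cyclic successor of `x` in the word `w`. -/
def cyclicSucc (w : List Pass) (x : Pass) : Pass :=
  if h : x ∈ w then w.next x h else x

/-- `(x, true)` stands for the directed edge that leaves the passage `x` along the orientation of
the knot, `(x, false)` for the one that leaves it against the orientation. A face is traced with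
the face on the left: walk along the edge to the next passage `y`, then turn left into the other
strand of that crossing. -/
def faceStep (w : List Pass) (d : Pass × Bool) : Pass × Bool :=
  let y := if d.2 then cyclicSucc w d.1 else cyclicSucc w.reverse d.1
  (y.flip, y.otherToLeft == d.2)

/-- The directed edges of the diagram. -/
abbrev Dart (w : List Pass) : Type := {d : Pass × Bool // d.1 ∈ w}

/-- The faces: the orbits of `faceStep` on the directed edges. -/
abbrev Faces (w : List Pass) : Type :=
  Quot fun d e : Dart w => faceStep w d.1 = e.1

/-- The surface obtained by filling the faces is a sphere. With `n` crossings there are `2 n` edges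
and the length of the word is `2 n`, so Euler's formula reads `#faces = n + 2`. The empty word is
the diagram without crossings, a simple closed curve. -/
def IsSpherical (w : List Pass) : Prop :=
  w = [] ∨ 2 * Nat.card (Faces w) = w.length + 4

/-- An oriented knot diagram on the sphere: a cyclic word in which every crossing occurs exactly
twice, once over and once under, with one sign, and whose underlying surface is the sphere. -/
structure KnotDiagram where
  word : List Pass
  nodup : (word.map fun x => (x.label, x.upper)).Nodup
  closed : ∀ x ∈ word, x.flip ∈ word
  spherical : IsSpherical word

/-- Two letters in the order `x y` or `y x`. -/
def arrange (e : Bool) (x y : Pass) : List Pass := if e then [x, y] else [y, x]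

/-- The moves on Gauss words: choice of the base point, renaming of the crossings and the three
Reidemeister moves, with all orientations of the strands and all signs.

In the second move `e` says whether the two strands of the bigon are parallel.

In the third move there are an upper strand, with crossings `a`, `b`, a middle strand, with
crossings `a`, `c`, and a lower strand, with crossings `b`, `c`. The bits `e₁ e₂ e₃` say in which
order each strand meets its two crossings; the three lines bound a triangle exactly if, for one
value of `o` (the orientation of the triangle `abc`), the signs of the crossings `a`, `b`, `c` are
the products `o e₁ e₂`, `o e₁ e₃`, `o e₂ e₃`, where `true` is read as `+1` and `false` as `-1`. The
move reverses the three orders. There are two constructors for the two cyclic orders in which the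
knot can run through the three strands. -/
inductive Move : List Pass → List Pass → Prop
  | rotate (u v : List Pass) : Move (u ++ v) (v ++ u)
  | relabel (σ : Equiv.Perm ℕ) (w : List Pass) : Move w (w.map (Pass.relabel σ))
  | r1 (a : ℕ) (t s : Bool) (w : List Pass) :
      Move ([⟨a, t, s⟩, ⟨a, !t, s⟩] ++ w) w
  | r2 (a b : ℕ) (s e : Bool) (u v : List Pass) :
      Move ([⟨a, true, s⟩, ⟨b, true, !s⟩] ++ u ++ arrange e ⟨a, false, s⟩ ⟨b, false, !s⟩ ++ v)
        (u ++ v)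
  | r3 (a b c : ℕ) (o e₁ e₂ e₃ sa sb sc : Bool) (u v w : List Pass)
      (ha : sa = (o == (e₁ == e₂))) (hb : sb = (o == (e₁ == e₃))) (hc : sc = (o == (e₂ == e₃))) :
      Move
        (arrange e₁ ⟨a, true, sa⟩ ⟨b, true, sb⟩ ++ u ++ arrange e₂ ⟨a, false, sa⟩ ⟨c, true, sc⟩ ++ v
          ++ arrange e₃ ⟨b, false, sb⟩ ⟨c, false, sc⟩ ++ w)
        (arrange (!e₁) ⟨a, true, sa⟩ ⟨b, true, sb⟩ ++ u
          ++ arrange (!e₂) ⟨a, false, sa⟩ ⟨c, true, sc⟩ ++ v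
          ++ arrange (!e₃) ⟨b, false, sb⟩ ⟨c, false, sc⟩ ++ w)
  | r3' (a b c : ℕ) (o e₁ e₂ e₃ sa sb sc : Bool) (u v w : List Pass)
      (ha : sa = (o == (e₁ == e₂))) (hb : sb = (o == (e₁ == e₃))) (hc : sc = (o == (e₂ == e₃))) :
      Move
        (arrange e₁ ⟨a, true, sa⟩ ⟨b, true, sb⟩ ++ u ++ arrange e₃ ⟨b, false, sb⟩ ⟨c, false, sc⟩ ++ v
          ++ arrange e₂ ⟨a, false, sa⟩ ⟨c, true, sc⟩ ++ w)
        (arrange (!e₁) ⟨a, true, sa⟩ ⟨b, true, sb⟩ ++ u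
          ++ arrange (!e₃) ⟨b, false, sb⟩ ⟨c, false, sc⟩ ++ v
          ++ arrange (!e₂) ⟨a, false, sa⟩ ⟨c, true, sc⟩ ++ w)

/-- `y` immediately follows `x` in the cyclic word `w`. -/
def Consecutive (w : List Pass) (x y : Pass) : Prop := ∃ u, w ~r (x :: y :: u)

/-- The crossings `a` and `b` form a matched pair: two counter-directed strands make one full
twist around each other. One strand runs from `a` directly to `b`, the other from `b` directly to
`a`, the crossings have the same sign, and each strand is over at exactly one of them. -/
def MatchedPair (w : List Pass) (a b : ℕ) : Prop :=
  a ≠ b ∧ ∃ o s : Bool,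
    Consecutive w ⟨a, o, s⟩ ⟨b, !o, s⟩ ∧ Consecutive w ⟨b, o, s⟩ ⟨a, !o, s⟩

namespace KnotDiagram

/-- Two diagrams represent the same oriented knot. -/
def Equivalent : KnotDiagram → KnotDiagram → Prop :=
  Relation.EqvGen fun D E => Move D.word E.word

/-- The crossings are split into matched pairs, `m` being the involution that pairs them. -/
def IsMatched (D : KnotDiagram) : Prop :=
  ∃ m : ℕ → ℕ, ∀ x ∈ D.word, m (m x.label) = x.label ∧ MatchedPair D.word x.label (m x.label)

/-- The knot represented by `K` has a matched diagram. The orientation of the knot plays no role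
here, since a diagram stays matched when the orientation is reversed. -/
def IsBipartite (K : KnotDiagram) : Prop :=
  ∃ D : KnotDiagram, Equivalent K D ∧ D.IsMatched

end KnotDiagram

theorem Pass.mirror_injective : Function.Injective Pass.mirror := by
  rintro ⟨a, o, s⟩ ⟨b, p, t⟩ h
  simpa [Pass.mirror] using h

theorem cyclicSucc_mirror (w : List Pass) (x : Pass) :
    cyclicSucc (w.map Pass.mirror) x.mirror = (cyclicSucc w x).mirror := by
  have key : ∀ (l : List Pass) (y : Pass),
      (l.map Pass.mirror).nextOr x.mirror y.mirror = (l.nextOr x y).mirror := by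
    intro l
    induction l with
    | nil => intro y; rfl
    | cons a l ih =>
      intro y
      cases l with
      | nil => rfl
      | cons b l =>
        by_cases hxa : x = a
        · simp [List.nextOr, hxa]
        · have h' : x.mirror ≠ a.mirror := fun h => hxa (Pass.mirror_injective h)
          simpa [List.nextOr, hxa, h'] using ih y
  by_cases h : x ∈ w
  · have h' : x.mirror ∈ w.map Pass.mirror := List.mem_map_of_mem h
    rw [cyclicSucc, cyclicSucc, dif_pos h, dif_pos h', List.next, List.next]
    convert key w _ using 2
    simp
  · have h' : x.mirror ∉ w.map Pass.mirror := by
      rw [List.mem_map_of_injective Pass.mirror_injective]; exact h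
    rw [cyclicSucc, cyclicSucc, dif_neg h, dif_neg h']

theorem faceStep_mirror (w : List Pass) (d : Pass × Bool) :
    faceStep (w.map Pass.mirror) (d.1.mirror, d.2) =
      ((faceStep w d).1.mirror, (faceStep w d).2) := by
  have hl : ∀ y : Pass, y.mirror.otherToLeft = y.otherToLeft := by
    rintro ⟨a, o, s⟩; cases o <;> cases s <;> rfl
  have hf : ∀ y : Pass, y.mirror.flip = y.flip.mirror := fun _ => rfl
  obtain ⟨x, b⟩ := d
  cases b <;> simp [faceStep, ← List.map_reverse, cyclicSucc_mirror, hl, hf]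

theorem card_faces_mirror (w : List Pass) :
    Nat.card (Faces (w.map Pass.mirror)) = Nat.card (Faces w) := by
  let f : Dart w → Dart (w.map Pass.mirror) :=
    fun d => ⟨(d.1.1.mirror, d.1.2), List.mem_map_of_mem d.2⟩
  have hf : Function.Bijective f := by
    constructor
    · rintro ⟨⟨x, b⟩, hx⟩ ⟨⟨y, c⟩, hy⟩ h
      have h' := congrArg Subtype.val h
      simp only [f, Prod.mk.injEq] at h'
      obtain ⟨h1, rfl⟩ := h'
      obtain rfl := Pass.mirror_injective h1
      rfl
    · rintro ⟨⟨x, b⟩, hx⟩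
      obtain ⟨y, hy, rfl⟩ := List.mem_map.1 hx
      exact ⟨⟨(y, b), hy⟩, rfl⟩
  refine (Nat.card_congr (Quot.congr (Equiv.ofBijective f hf) ?_)).symm
  rintro ⟨⟨x, b⟩, hx⟩ ⟨⟨y, c⟩, hy⟩
  have h := faceStep_mirror w (x, b)
  simp only [Equiv.ofBijective_apply, f]
  rw [h, Prod.ext_iff, Prod.ext_iff]
  simp only [Pass.mirror_injective.eq_iff]

/-- The mirror image of a diagram: all crossings are switched. -/
def KnotDiagram.mirror (D : KnotDiagram) : KnotDiagram where
  word := D.word.map Pass.mirror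
  nodup := by
    have h := D.nodup.map (f := fun p : ℕ × Bool => (p.1, !p.2)) (by
      rintro ⟨a, b⟩ ⟨c, d⟩ h; simpa using h)
    rw [List.map_map] at h ⊢
    exact h
  closed := by
    intro x hx
    obtain ⟨y, hy, rfl⟩ := List.mem_map.1 hx
    exact List.mem_map.2 ⟨y.flip, D.closed y hy, rfl⟩
  spherical := by
    rcases D.spherical with h | h
    · exact Or.inl (by simp [h])
    · exact Or.inr (by rw [card_faces_mirror, h, List.length_map])

/-- A directed edge of least code among the first `k + 1` edges of the face that starts at `d`. -/
def faceRep (w : List Pass) : ℕ → Pass × Bool → Pass × Bool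
  | 0, d => d
  | k + 1, d =>
    let code := fun e : Pass × Bool => 4 * e.1.label + 2 * e.1.upper.toNat + e.2.toNat
    let r := faceRep w k (faceStep w d)
    if Nat.ble (code d) (code r) then d else r

/-- A list of the directed edges. -/
def dartList (w : List Pass) : List (Pass × Bool) := w.flatMap fun x => [(x, true), (x, false)]

theorem mem_dartList {w : List Pass} {d : Pass × Bool} : d ∈ dartList w ↔ d.1 ∈ w := by
  obtain ⟨x, b⟩ := d
  cases b <;> simp [dartList]

/-- Counting faces by representatives. -/
theorem isSpherical_of_faceRep (w : List Pass) (k : ℕ)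
    (h₁ : ∀ d ∈ dartList w, faceStep w d ∈ dartList w)
    (h₂ : ∀ d ∈ dartList w, faceRep w k (faceStep w d) = faceRep w k d)
    (h₃ : 2 * ((dartList w).map (faceRep w k)).dedup.length = w.length + 4) :
    IsSpherical w := by
  right
  have hrep : ∀ (j : ℕ) (d : Dart w), ∃ h : (faceRep w j d.1).1 ∈ w,
      (Quot.mk _ ⟨faceRep w j d.1, h⟩ : Faces w) = Quot.mk _ d := by
    intro j
    induction j with
    | zero => intro d; exact ⟨d.2, rfl⟩
    | succ j ih =>
      intro d
      have hs := mem_dartList.1 (h₁ d.1 (mem_dartList.2 d.2))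
      obtain ⟨hm, he⟩ := ih ⟨faceStep w d.1, hs⟩
      have hstep : (Quot.mk _ d : Faces w) = Quot.mk _ ⟨faceStep w d.1, hs⟩ := Quot.sound rfl
      have hcase : faceRep w (j + 1) d.1 = d.1 ∨
          faceRep w (j + 1) d.1 = faceRep w j (faceStep w d.1) := by
        simp only [faceRep]
        split_ifs
        · exact Or.inl rfl
        · exact Or.inr rfl
      rcases hcase with h | h
      · have h' : (⟨faceRep w (j + 1) d.1, by rw [h]; exact d.2⟩ : Dart w) = d := Subtype.ext h
        exact ⟨by rw [h]; exact d.2, congrArg _ h'⟩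
      · have h' : (⟨faceRep w (j + 1) d.1, by rw [h]; exact hm⟩ : Dart w)
            = ⟨faceRep w j (faceStep w d.1), hm⟩ := Subtype.ext h
        exact ⟨by rw [h]; exact hm, (congrArg _ h').trans (he.trans hstep.symm)⟩
  let g : Faces w → Pass × Bool := Quot.lift (fun d => faceRep w k d.1) (by
    intro d e hde
    have := h₂ d.1 (mem_dartList.2 d.2)
    rw [hde] at this
    exact this.symm)
  have hg : Function.Injective g := by
    intro p q
    induction p using Quot.ind with | _ d => ?_
    induction q using Quot.ind with | _ e => ?_
    intro h
    obtain ⟨hd, hd'⟩ := hrep k d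
    obtain ⟨he, he'⟩ := hrep k e
    rw [← hd', ← he']
    exact congrArg _ (Subtype.ext h)
  have hr : Set.range g = (((dartList w).map (faceRep w k)).toFinset : Set (Pass × Bool)) := by
    ext r
    simp only [Set.mem_range, List.coe_toFinset, List.mem_map, Set.mem_ofPred_eq]
    constructor
    · rintro ⟨p, rfl⟩
      induction p using Quot.ind with | _ d => ?_
      exact ⟨d.1, mem_dartList.2 d.2, rfl⟩
    · rintro ⟨d, hd, rfl⟩
      exact ⟨Quot.mk _ ⟨d, mem_dartList.1 hd⟩, rfl⟩
  have hc : Nat.card (Faces w) = ((dartList w).map (faceRep w k)).dedup.length := by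
    rw [← Nat.card_range_of_injective hg, hr, Nat.card_coe_set_eq, Set.ncard_coe_finset,
      List.card_toFinset]
  rw [hc, h₃]

/-- The Gauss word of a planar diagram code. The edges of the diagram are numbered `1, …, N` along
the knot, and `(i, j, k, l)` lists the edges at a crossing counterclockwise, beginning with the
incoming lower edge `i`. The crossing is positive if the upper strand runs from `l` to `j`. -/
def gaussWord (code : List (ℕ × ℕ × ℕ × ℕ)) : List Pass :=
  let N := 2 * code.length
  (List.range N).flatMap fun p => code.zipIdx.flatMap fun q =>
    let i := q.1.1
    let j := q.1.2.1
    let l := q.1.2.2.2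
    let positive := j == l % N + 1
    (if i = p + 1 then [⟨q.2, false, positive⟩] else []) ++
      (if (if positive then l else j) = p + 1 then [⟨q.2, true, positive⟩] else [])

/-- The diagram given by a planar diagram code, once the code has been checked. -/
def KnotDiagram.ofPD (code : List (ℕ × ℕ × ℕ × ℕ))
    (h : ((gaussWord code).map fun x => (x.label, x.upper)).Nodup ∧
      (∀ x ∈ gaussWord code, x.flip ∈ gaussWord code) ∧
      (∀ d ∈ dartList (gaussWord code),
        faceStep (gaussWord code) d ∈ dartList (gaussWord code)) ∧
      (∀ d ∈ dartList (gaussWord code),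
        faceRep (gaussWord code) 8 (faceStep (gaussWord code) d) =
          faceRep (gaussWord code) 8 d) ∧
      2 * ((dartList (gaussWord code)).map (faceRep (gaussWord code) 8)).dedup.length =
        (gaussWord code).length + 4) : KnotDiagram where
  word := gaussWord code
  nodup := h.1
  closed := h.2.1
  spherical := isSpherical_of_faceRep _ 8 h.2.2.1 h.2.2.2.1 h.2.2.2.2

/-- The knot `9_35` of Rolfsen's table, in Conway's notation `3,3,3`. -/
def knot9_35 : KnotDiagram :=
  KnotDiagram.ofPD [(2, 14, 3, 13), (4, 12, 5, 11), (6, 16, 7, 15), (8, 2, 9, 1), (10, 18, 11, 17),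
    (12, 4, 13, 3), (14, 8, 15, 7), (16, 6, 17, 5), (18, 10, 1, 9)]
    (by decide +kernel)

/-- The knot `9_37` of Rolfsen's table, in Conway's notation `3,21,21`. -/
def knot9_37 : KnotDiagram :=
  KnotDiagram.ofPD [(2, 11, 3, 12), (4, 2, 5, 1), (6, 14, 7, 13), (8, 17, 9, 18), (10, 3, 11, 4),
    (12, 8, 13, 7), (14, 6, 15, 5), (16, 9, 17, 10), (18, 16, 1, 15)]
    (by decide +kernel)

/-- The knot `9_41` of Rolfsen's table, in Conway's notation `20:20:20`. -/
def knot9_41 : KnotDiagram :=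
  KnotDiagram.ofPD [(2, 11, 3, 12), (4, 15, 5, 16), (6, 2, 7, 1), (8, 17, 9, 18), (10, 3, 11, 4),
    (12, 8, 13, 7), (14, 5, 15, 6), (16, 9, 17, 10), (18, 14, 1, 13)]
    (by decide +kernel)

/-- The knot `9_46` of Rolfsen's table, in Conway's notation `3,3,21-`. -/
def knot9_46 : KnotDiagram :=
  KnotDiagram.ofPD [(2, 11, 3, 12), (4, 2, 5, 1), (5, 14, 6, 15), (7, 12, 8, 13), (9, 17, 10, 16),
    (10, 3, 11, 4), (13, 6, 14, 7), (15, 18, 16, 1), (17, 9, 18, 8)]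
    (by decide +kernel)

/-- The standard diagram of the pretzel knot with parameters `(3, 3, -3)`. -/
def pretzel33neg3 : KnotDiagram :=
  KnotDiagram.ofPD [(1, 12, 2, 13), (3, 10, 4, 11), (5, 14, 6, 15), (8, 18, 9, 17), (11, 2, 12, 3),
    (13, 6, 14, 7), (15, 4, 16, 5), (16, 10, 17, 9), (18, 8, 1, 7)]
    (by decide +kernel)

/-- The knot `9_47` of Rolfsen's table, in Conway's notation `8*-20`. -/
def knot9_47 : KnotDiagram :=
  KnotDiagram.ofPD [(2, 15, 3, 16), (4, 14, 5, 13), (6, 2, 7, 1), (8, 3, 9, 4), (10, 6, 11, 5),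
    (11, 1, 12, 18), (14, 9, 15, 10), (16, 8, 17, 7), (17, 13, 18, 12)]
    (by decide +kernel)

/-- The knot `9_48` of Rolfsen's table, in Conway's notation `21,21,21-`. -/
def knot9_48 : KnotDiagram :=
  KnotDiagram.ofPD [(2, 11, 3, 12), (4, 2, 5, 1), (5, 14, 6, 15), (7, 12, 8, 13), (8, 17, 9, 18),
    (10, 3, 11, 4), (13, 6, 14, 7), (16, 9, 17, 10), (18, 16, 1, 15)]
    (by decide +kernel)

/-- The knot `9_49` of Rolfsen's table, in Conway's notation `-20:-20:-20`. -/
def knot9_49 : KnotDiagram :=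
  KnotDiagram.ofPD [(3, 11, 4, 10), (5, 15, 6, 14), (6, 2, 7, 1), (9, 17, 10, 16), (11, 3, 12, 2),
    (12, 8, 13, 7), (15, 5, 16, 4), (17, 9, 18, 8), (18, 14, 1, 13)]
    (by decide +kernel)

/-- The knot `10_74` of Rolfsen's table, in Conway's notation `3,3,21+`. -/
def knot10_74 : KnotDiagram :=
  KnotDiagram.ofPD [(2, 13, 3, 14), (4, 2, 5, 1), (6, 18, 7, 17), (8, 16, 9, 15), (10, 20, 11, 19),
    (12, 3, 13, 4), (14, 6, 15, 5), (16, 8, 17, 7), (18, 12, 19, 11), (20, 10, 1, 9)]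
    (by decide +kernel)

/-- The knot `10_75` of Rolfsen's table, in Conway's notation `21,21,21+`. -/
def knot10_75 : KnotDiagram :=
  KnotDiagram.ofPD [(1, 11, 2, 10), (3, 15, 4, 14), (5, 19, 6, 18), (7, 20, 8, 1), (9, 3, 10, 2),
    (11, 8, 12, 9), (13, 5, 14, 4), (15, 12, 16, 13), (17, 7, 18, 6), (19, 16, 20, 17)]
    (by decide +kernel)

/-- The knot `10_103` of Rolfsen's table, in Conway's notation `30:2:2`. -/
def knot10_103 : KnotDiagram :=
  KnotDiagram.ofPD [(2, 18, 3, 17), (4, 11, 5, 12), (6, 2, 7, 1), (8, 15, 9, 16), (10, 3, 11, 4),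
    (12, 19, 13, 20), (14, 9, 15, 10), (16, 7, 17, 8), (18, 6, 19, 5), (20, 13, 1, 14)]
    (by decide +kernel)

/-- The knot `10_155` of Rolfsen's table, in Conway's notation `-3:2:2`. -/
def knot10_155 : KnotDiagram :=
  KnotDiagram.ofPD [(2, 15, 3, 16), (4, 11, 5, 12), (6, 2, 7, 1), (8, 18, 9, 17), (10, 3, 11, 4),
    (13, 20, 14, 1), (14, 5, 15, 6), (16, 8, 17, 7), (18, 10, 19, 9), (19, 12, 20, 13)]
    (by decide +kernel)

/-- The knot `10_157` of Rolfsen's table, in Conway's notation `-3:20:20`. -/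
def knot10_157 : KnotDiagram :=
  KnotDiagram.ofPD [(3, 10, 4, 11), (5, 18, 6, 19), (6, 2, 7, 1), (8, 15, 9, 16), (9, 2, 10, 3),
    (11, 17, 12, 16), (12, 19, 13, 20), (14, 7, 15, 8), (17, 4, 18, 5), (20, 13, 1, 14)]
    (by decide +kernel)

/-! The invariant asks whether Fox colourings can be deformed to first order. For a unit `t`, the
rule `x ↦ t x + (1 - t) y` makes a module a quandle. Over `𝔽_p` with `t = -1` it gives Fox's
colourings, and over the dual numbers `𝔽_p[ε] / ε²` with `t = -1 + ε` (the quandle `Jet p`) it gives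
first-order deformations of them. Reidemeister moves match the colourings of two diagrams in a way
that is natural in the quandle. Hence the property `Lifts`, that every Fox colouring is the
reduction modulo `ε` of a colouring by `Jet p`, depends only on the knot
(`KnotDiagram.Equivalent.lifts_iff`).

Matched diagrams have this property for every odd prime `p` (`TwistPairing.lifts`). A strand that
runs through a twist keeps the face on the side of the bigon and exchanges the face on the other
side for the one across the twist; the second strand of the twist does the opposite exchange. A Fox
colouring `g` also changes by opposite amounts along the two strands. One can therefore look for a
function `φ` on the faces, zero on the bigons, such that `g = φ(left) + φ(right)` on every edge
outside the twists. A walk along the knot shows that `φ` is determined by its values on both sides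
of one edge and by one coordinate for each crossing. Euler's formula says that there are exactly as
many faces as such data, so `φ` exists (`TwistPairing.exists_face_function`). The slopes `-(φ(right)
- φ(left)) / 4` on the same edges then satisfy the relations of a lift (`TwistPairing.slope_twist`).
Sphericity is used only in this dimension count.

For a fixed Fox colouring, the slopes of a lift solve an inhomogeneous linear system. A functional
that annihilates its homogeneous part but not its constant term rules out a lift
(`not_lifts_of_obstructionTrace`). For each listed diagram and its mirror image, such a colouring
and functional modulo 3, 5 or 7 are written down and checked by computation. -/

/-- A set of colours with the two mutually inverse operations of a quandle: `act s x y` is the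
colour in which a strand of colour `x` continues after it has passed under a strand of colour `y`
at a crossing that is positive if `s = true`. -/
class SignedQuandle (Q : Type*) where
  act : Bool → Q → Q → Q
  act_self (s : Bool) (x : Q) : act s x x = x
  act_act_not (s : Bool) (x y : Q) : act (!s) (act s x y) y = x
  act_act (s t : Bool) (x y z : Q) : act s (act t x y) z = act t (act s x z) (act s y z)

open SignedQuandle in
theorem act_not_act {Q : Type*} [SignedQuandle Q] (s : Bool) (x y : Q) :
    act s (act (!s) x y) y = x := by
  simpa using act_act_not (!s) x y

/-! ### Quandle colourings of Gauss words and the lifting property -/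

section Colouring

open SignedQuandle

variable {Q Q' : Type*} [SignedQuandle Q] [SignedQuandle Q']

/-- With `f c` the colour of the upper strand at the crossing `c`, a strand that starts with the
colour `x` and runs through the passages of `w` ends with the colour `y`. -/
def Runs (f : ℕ → Q) : Q → List Pass → Q → Prop
  | x, [], y => x = y
  | x, p :: w, y =>
    if p.upper then x = f p.label ∧ Runs f x w y else Runs f (act p.pos x (f p.label)) w y

@[simp] theorem runs_nil {f : ℕ → Q} {x y : Q} : Runs f x [] y ↔ x = y := Iff.rfl

@[simp] theorem runs_over {f : ℕ → Q} {x y : Q} {a : ℕ} {s : Bool} {w : List Pass} :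
    Runs f x (⟨a, true, s⟩ :: w) y ↔ x = f a ∧ Runs f x w y := by
  simp [Runs]

@[simp] theorem runs_under {f : ℕ → Q} {x y : Q} {a : ℕ} {s : Bool} {w : List Pass} :
    Runs f x (⟨a, false, s⟩ :: w) y ↔ Runs f (act s x (f a)) w y := by
  simp [Runs]

theorem runs_append {f : ℕ → Q} {u v : List Pass} {x y : Q} :
    Runs f x (u ++ v) y ↔ ∃ z, Runs f x u z ∧ Runs f z v y := by
  induction u generalizing x with
  | nil => simp
  | cons p u ih =>
    obtain ⟨a, o, s⟩ := p
    cases o <;> simp [ih, and_assoc]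

theorem runs_congr {f g : ℕ → Q} {w : List Pass} (h : ∀ p ∈ w, f p.label = g p.label) {x y : Q} :
    Runs f x w y ↔ Runs g x w y := by
  induction w generalizing x with
  | nil => simp
  | cons p w ih =>
    have hp := h p (by simp)
    have ih' := fun {x} => ih (x := x) (fun q hq => h q (by simp [hq]))
    simp only [Runs, hp, ih']

theorem runs_relabel {f : ℕ → Q} {σ : Equiv.Perm ℕ} {w : List Pass} {x y : Q} :
    Runs f x (w.map (Pass.relabel σ)) y ↔ Runs (f ∘ σ) x w y := by
  induction w generalizing x with
  | nil => simp
  | cons p w ih => simp [Runs, Pass.relabel, ih]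

/-- An over passage keeps the colour and an under passage applies a function to it, so the initial
colour determines the final one. -/
theorem Runs.unique {f : ℕ → Q} {w : List Pass} {x y z : Q} (hy : Runs f x w y)
    (hz : Runs f x w z) : y = z := by
  induction w generalizing x with
  | nil => exact (runs_nil.1 hy).symm.trans (runs_nil.1 hz)
  | cons p w ih =>
    obtain ⟨a, o, s⟩ := p
    cases o
    · exact ih (runs_under.1 hy) (runs_under.1 hz)
    · exact ih (runs_over.1 hy).2 (runs_over.1 hz).2

/-- A map of colours that respects the operations. -/
def Respects (π : Q → Q') : Prop := ∀ s x y, π (act s x y) = act s (π x) (π y)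

theorem Runs.map {π : Q → Q'} (hπ : Respects π) {f : ℕ → Q} {g : ℕ → Q'} {w : List Pass} {x y : Q}
    (hg : ∀ p ∈ w, π (f p.label) = g p.label) (h : Runs f x w y) : Runs g (π x) w (π y) := by
  induction w generalizing x with
  | nil => exact congrArg π (runs_nil.1 h)
  | cons p w ih =>
    have hp := hg p (by simp)
    have ih' := fun {x} => ih (x := x) (fun q hq => hg q (by simp [hq]))
    obtain ⟨a, o, s⟩ := p
    cases o
    · have := ih' (runs_under.1 h)
      rw [hπ, hp] at this
      exact runs_under.2 this
    · obtain ⟨h₁, h₂⟩ := runs_over.1 h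
      exact runs_over.2 ⟨by rw [h₁]; exact hp, ih' h₂⟩

/-- Every colouring of the closed word `w` by `Q'` lifts along `π` to a colouring by `Q`. -/
def Lifts (π : Q → Q') (w : List Pass) : Prop :=
  ∀ (f : ℕ → Q') (x : Q'), Runs f x w x →
    ∃ (g : ℕ → Q) (y : Q), (∀ p ∈ w, π (g p.label) = f p.label) ∧ π y = x ∧ Runs g y w y

theorem Lifts.rotate {π : Q → Q'} (hπ : Respects π) {u v : List Pass} (h : Lifts π (u ++ v)) :
    Lifts π (v ++ u) := by
  intro f z hz
  obtain ⟨x, hv, hu⟩ := runs_append.1 hz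
  obtain ⟨g, y, hg, rfl, hy⟩ := h f x (runs_append.2 ⟨z, hu, hv⟩)
  obtain ⟨z', hu', hv'⟩ := runs_append.1 hy
  have hmem : ∀ p, p ∈ v ++ u → p ∈ u ++ v := fun p hp => by simpa [or_comm] using hp
  refine ⟨g, z', fun p hp => hg p (hmem p hp), ?_, runs_append.2 ⟨y, hv', hu'⟩⟩
  -- The lifted state at the new base point projects to a state reached from `x` along `u`, and that
  -- state is unique.
  exact (hu'.map hπ fun p hp => hg p (by simp [hp])).unique hu

theorem Lifts.relabel {π : Q → Q'} {w : List Pass} (σ : Equiv.Perm ℕ) (h : Lifts π w) :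
    Lifts π (w.map (Pass.relabel σ)) := by
  intro f x hx
  obtain ⟨g, y, hg, hy, hr⟩ := h _ x (runs_relabel.1 hx)
  refine ⟨g ∘ σ.symm, y, ?_, hy, runs_relabel.2 ?_⟩
  · intro p hp
    obtain ⟨q, hq, rfl⟩ := List.mem_map.1 hp
    simpa [Pass.relabel] using hg q hq
  · simpa [Function.comp_assoc] using hr

theorem Lifts.of_relabel {π : Q → Q'} {w : List Pass} {σ : Equiv.Perm ℕ}
    (h : Lifts π (w.map (Pass.relabel σ))) : Lifts π w := by
  have := h.relabel σ.symm
  have hw : (w.map (Pass.relabel σ)).map (Pass.relabel σ.symm) = w := by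
    rw [List.map_map]
    conv_rhs => rw [← List.map_id w]
    refine List.map_congr_left fun p _ => ?_
    simp [Pass.relabel]
  rwa [hw] at this

/-! ### Invariance of lifting under the Reidemeister moves -/

theorem runs_update {f : ℕ → Q} {a : ℕ} {c : Q} {w : List Pass} (h : ∀ p ∈ w, p.label ≠ a)
    {x y : Q} : Runs (Function.update f a c) x w y ↔ Runs f x w y :=
  runs_congr fun p hp => Function.update_of_ne (h p hp) _ _

/-- No passage occurs twice in the word. -/
def NodupKeys (w : List Pass) : Prop := (w.map fun x => (x.label, x.upper)).Nodup

/-- Once `l` contains both passages through `a`, none is left for the rest of the word. -/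
theorem label_ne_of_nodup {l u w : List Pass} (hw : NodupKeys w) (hp : w.Perm (l ++ u)) {a : ℕ}
    (ha : ∀ o, (a, o) ∈ l.map fun x => (x.label, x.upper)) : ∀ p ∈ u, p.label ≠ a := by
  intro p hpu hpa
  rw [NodupKeys, (hp.map _).nodup_iff, List.map_append] at hw
  exact (List.disjoint_of_nodup_append hw) (ha p.upper)
    (List.mem_map.2 ⟨p, hpu, by rw [hpa]⟩)

theorem runs_kink {f : ℕ → Q} {a : ℕ} {t s : Bool} {x y : Q} :
    Runs f x [⟨a, t, s⟩, ⟨a, !t, s⟩] y ↔ f a = x ∧ x = y := by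
  cases t
  · simp only [Bool.not_false, runs_under, runs_over, runs_nil]
    constructor
    · rintro ⟨h₁, h₂⟩
      have : x = f a := by rw [← act_act_not s x (f a), h₁, act_self]
      exact ⟨this.symm, by rw [← h₂, h₁, this]⟩
    · rintro ⟨rfl, rfl⟩
      simp [act_self]
  · simp only [Bool.not_true, runs_under, runs_over, runs_nil]
    constructor
    · rintro ⟨h₁, h₂⟩
      exact ⟨h₁.symm, by rw [← h₂, ← h₁, act_self]⟩
    · rintro ⟨rfl, rfl⟩
      simp [act_self]

theorem runs_kink_append {f : ℕ → Q} {a : ℕ} {t s : Bool} {w : List Pass} {x : Q} :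
    Runs f x ([⟨a, t, s⟩, ⟨a, !t, s⟩] ++ w) x ↔ f a = x ∧ Runs f x w x := by
  rw [runs_append]
  simp only [runs_kink]
  constructor
  · rintro ⟨z, ⟨h, rfl⟩, hz⟩
    exact ⟨h, hz⟩
  · rintro ⟨h, hz⟩
    exact ⟨x, ⟨h, rfl⟩, hz⟩

/-- Idempotence forces the crossing of the kink to carry the colour of the base point. It occurs
nowhere else, so its colour can be added or dropped freely, both downstairs and upstairs. -/
theorem lifts_kink_iff {π : Q → Q'} {a : ℕ} {t s : Bool} {w : List Pass}
    (hw : NodupKeys ([⟨a, t, s⟩, ⟨a, !t, s⟩] ++ w)) :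
    Lifts π ([⟨a, t, s⟩, ⟨a, !t, s⟩] ++ w) ↔ Lifts π w := by
  have ha : ∀ p ∈ w, p.label ≠ a := label_ne_of_nodup hw (List.Perm.refl _)
    (by intro o; cases t <;> cases o <;> simp)
  constructor
  · intro h f x hx
    obtain ⟨g, y, hg, hy, hr⟩ := h (Function.update f a x) x
      (runs_kink_append.2 ⟨by simp, (runs_update ha).2 hx⟩)
    refine ⟨g, y, fun p hp => ?_, hy, (runs_kink_append.1 hr).2⟩
    rw [hg p (by simp [hp]), Function.update_of_ne (ha p hp)]
  · intro h f x hx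
    obtain ⟨hfa, hx⟩ := runs_kink_append.1 hx
    obtain ⟨g, y, hg, hy, hr⟩ := h f x hx
    refine ⟨Function.update g a y, y, fun p hp => ?_, hy,
      runs_kink_append.2 ⟨by simp, (runs_update ha).2 hr⟩⟩
    by_cases hpa : p.label = a
    · simp [hpa, hy, hfa]
    · have hpw : p ∈ w := by
        simp only [List.cons_append, List.nil_append, List.mem_cons] at hp
        rcases hp with rfl | rfl | hp
        · exact absurd rfl hpa
        · exact absurd rfl hpa
        · exact hp
      rw [Function.update_of_ne hpa, hg p hpw]

theorem runs_over_pair {f : ℕ → Q} {a b : ℕ} {s t : Bool} {x y : Q} :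
    Runs f x [⟨a, true, s⟩, ⟨b, true, t⟩] y ↔ f a = x ∧ f b = x ∧ x = y := by
  simp only [runs_over, runs_nil, eq_comm]

theorem runs_under_pair {f : ℕ → Q} {a b : ℕ} {s e : Bool} (hab : f a = f b) {x y : Q} :
    Runs f x (arrange e ⟨a, false, s⟩ ⟨b, false, !s⟩) y ↔ x = y := by
  cases e <;> simp [arrange, hab, act_act_not, act_not_act]

theorem runs_clasp_append {f : ℕ → Q} {a b : ℕ} {s e : Bool} {u v : List Pass} {x : Q} :
    Runs f x ([⟨a, true, s⟩, ⟨b, true, !s⟩] ++ u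
      ++ arrange e ⟨a, false, s⟩ ⟨b, false, !s⟩ ++ v) x ↔
      f a = x ∧ f b = x ∧ Runs f x (u ++ v) x := by
  simp only [runs_append, runs_over_pair]
  constructor
  · rintro ⟨z, ⟨t, ⟨r, ⟨h₁, h₂, rfl⟩, h₃⟩, h₄⟩, h₅⟩
    rw [runs_under_pair (h₁.trans h₂.symm)] at h₄
    exact ⟨h₁, h₂, z, h₄ ▸ h₃, h₅⟩
  · rintro ⟨h₁, h₂, z, h₃, h₄⟩
    exact ⟨z, ⟨z, ⟨x, ⟨h₁, h₂, rfl⟩, h₃⟩, (runs_under_pair (h₁.trans h₂.symm)).2 rfl⟩, h₄⟩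

/-- The upper strand gives both crossings its own colour, so the lower strand undergoes an operation
followed by its inverse. The two colours are thus determined by the rest and occur nowhere else. -/
theorem lifts_clasp_iff {π : Q → Q'} {a b : ℕ} {s e : Bool} {u v : List Pass}
    (hw : NodupKeys ([⟨a, true, s⟩, ⟨b, true, !s⟩] ++ u
      ++ arrange e ⟨a, false, s⟩ ⟨b, false, !s⟩ ++ v)) :
    Lifts π ([⟨a, true, s⟩, ⟨b, true, !s⟩] ++ u ++ arrange e ⟨a, false, s⟩ ⟨b, false, !s⟩ ++ v) ↔
      Lifts π (u ++ v) := by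
  have hperm : ([(⟨a, true, s⟩ : Pass), ⟨b, true, !s⟩] ++ u
      ++ arrange e ⟨a, false, s⟩ ⟨b, false, !s⟩ ++ v).Perm
      (([⟨a, true, s⟩, ⟨b, true, !s⟩] ++ arrange e ⟨a, false, s⟩ ⟨b, false, !s⟩)
        ++ (u ++ v)) := by
    simp only [List.append_assoc]
    refine List.Perm.append_left _ ?_
    rw [← List.append_assoc, ← List.append_assoc]
    exact List.Perm.append_right _ List.perm_append_comm
  have ha : ∀ p ∈ u ++ v, p.label ≠ a := label_ne_of_nodup hw hperm
    (by intro o; cases e <;> cases o <;> simp [arrange])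
  have hb : ∀ p ∈ u ++ v, p.label ≠ b := label_ne_of_nodup hw hperm
    (by intro o; cases e <;> cases o <;> simp [arrange])
  have hmem : ∀ p ∈ [(⟨a, true, s⟩ : Pass), ⟨b, true, !s⟩] ++ u
      ++ arrange e ⟨a, false, s⟩ ⟨b, false, !s⟩ ++ v, p.label = a ∨ p.label = b ∨ p ∈ u ++ v := by
    intro p hp
    rw [hperm.mem_iff, List.mem_append] at hp
    rcases hp with hp | hp
    · cases e <;> simp only [arrange, List.mem_append, List.mem_cons, if_true, if_false,
        List.not_mem_nil, Bool.false_eq_true, or_false] at hp <;>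
      rcases hp with (rfl | rfl) | rfl | rfl <;> simp
    · exact Or.inr (Or.inr hp)
  constructor
  · intro h f x hx
    obtain ⟨g, y, hg, hy, hr⟩ := h (Function.update (Function.update f a x) b x) x
      (runs_clasp_append.2 ⟨by simp [Function.update_apply], by simp,
        (runs_update hb).2 ((runs_update ha).2 hx)⟩)
    refine ⟨g, y, fun p hp => ?_, hy, (runs_clasp_append.1 hr).2.2⟩
    rw [hg p (hperm.mem_iff.2 (List.mem_append_right _ hp)), Function.update_of_ne (hb p hp),
      Function.update_of_ne (ha p hp)]
  · intro h f x hx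
    obtain ⟨hfa, hfb, hx⟩ := runs_clasp_append.1 hx
    obtain ⟨g, y, hg, hy, hr⟩ := h f x hx
    refine ⟨Function.update (Function.update g a y) b y, y, fun p hp => ?_, hy,
      runs_clasp_append.2 ⟨by simp [Function.update_apply], by simp,
        (runs_update hb).2 ((runs_update ha).2 hr)⟩⟩
    by_cases hpb : p.label = b
    · simp [hpb, hy, hfb]
    by_cases hpa : p.label = a
    · simp [Function.update_apply, hpa, hy, hfa]
    rw [Function.update_of_ne hpb, Function.update_of_ne hpa]
    exact hg p (((hmem p hp).resolve_left hpa).resolve_left hpb)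

theorem not_beq_not (x y : Bool) : ((!x) == !y) = (x == y) := by
  cases x <;> cases y <;> rfl

/-- The effect of the third Reidemeister move on the colours of its three strands: only the colour
of the middle strand at its crossing with the lower strand changes. -/
theorem runs_triangle {f : ℕ → Q} {a b c : ℕ} {o e₁ e₂ e₃ sa sb sc : Bool}
    (ha : sa = (o == (e₁ == e₂))) (hb : sb = (o == (e₁ == e₃)))
    (hac : a ≠ c) (hbc : b ≠ c) {x₁ y₁ x₂ y₂ x₃ y₃ : Q}
    (h₁ : Runs f x₁ (arrange e₁ ⟨a, true, sa⟩ ⟨b, true, sb⟩) y₁)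
    (h₂ : Runs f x₂ (arrange e₂ ⟨a, false, sa⟩ ⟨c, true, sc⟩) y₂)
    (h₃ : Runs f x₃ (arrange e₃ ⟨b, false, sb⟩ ⟨c, false, sc⟩) y₃) :
    Runs (Function.update f c (act (sa ^^ e₂) (f c) (f a))) x₁
        (arrange (!e₁) ⟨a, true, sa⟩ ⟨b, true, sb⟩) y₁ ∧
      Runs (Function.update f c (act (sa ^^ e₂) (f c) (f a))) x₂
        (arrange (!e₂) ⟨a, false, sa⟩ ⟨c, true, sc⟩) y₂ ∧
      Runs (Function.update f c (act (sa ^^ e₂) (f c) (f a))) x₃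
        (arrange (!e₃) ⟨b, false, sb⟩ ⟨c, false, sc⟩) y₃ := by
  have hab : f b = f a := by
    cases e₁ <;> simp only [arrange, if_true, if_false, Bool.false_eq_true, runs_over] at h₁
    · exact h₁.1.symm.trans h₁.2.1
    · exact h₁.2.1.symm.trans h₁.1
  refine ⟨?_, ?_, ?_⟩
  · cases e₁ <;> simp [arrange, hac, hbc] at h₁ ⊢ <;> tauto
  · cases e₂
    · simp only [arrange, if_false, Bool.false_eq_true, runs_over, runs_under, runs_nil] at h₂
      obtain ⟨rfl, rfl⟩ := h₂
      simp [arrange, hac]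
    · simp only [arrange, if_true, runs_over, runs_under, runs_nil] at h₂
      obtain ⟨h₂, rfl⟩ := h₂
      simp [arrange, hac, ← h₂, act_act_not]
  -- As signs, `sa e₂` and `sb e₃` both equal `o e₁`: the shift of the middle colour is the same
  -- whether read at `a` or at `b`. This uses the sign conditions for a triangle.
  -- Self-distributivity then moves the lower strand across.
  · have hs : (sa ^^ e₂) = (sb ^^ e₃) := by
      subst ha hb
      cases o <;> cases e₁ <;> cases e₂ <;> cases e₃ <;> rfl
    rw [hs]
    cases e₃
    · simp only [arrange, if_false, Bool.false_eq_true, runs_under, runs_nil] at h₃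
      simp [arrange, hbc, hab, ← h₃, act_act sb sc]
    · simp only [arrange, if_true, runs_under, runs_nil] at h₃
      simp [arrange, hbc, hab, ← h₃, act_act sb sc, act_not_act]

/-- Two words whose colourings correspond to each other by a change of one colour. -/
theorem Lifts.of_change {π : Q → Q'} (hπ : Respects π) {w w' : List Pass} {a c : ℕ} {σ : Bool}
    (hac : a ≠ c) (ha : ∃ p ∈ w, p.label = a) (hc : ∃ p ∈ w, p.label = c)
    (hmem : ∀ p ∈ w', p ∈ w)
    (hw' : ∀ (f : ℕ → Q') x, Runs f x w' x →
      Runs (Function.update f c (act σ (f c) (f a))) x w x)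
    (hw : ∀ (f : ℕ → Q) x, Runs f x w x →
      Runs (Function.update f c (act (!σ) (f c) (f a))) x w' x)
    (h : Lifts π w) : Lifts π w' := by
  intro f x hx
  -- The colouring is carried to `w`, lifted there, and carried back. Since `π` respects the
  -- operations and `!σ` undoes `σ`, the result lies over `f`.
  obtain ⟨g, y, hg, hy, hr⟩ := h _ x (hw' f x hx)
  refine ⟨_, y, fun p hp => ?_, hy, hw g y hr⟩
  by_cases hpc : p.label = c
  · obtain ⟨q, hq, rfl⟩ := ha
    obtain ⟨r, hr, rfl⟩ := hc
    have hga := hg q hq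
    have hgc := hg r hr
    rw [Function.update_self] at hgc
    rw [Function.update_of_ne hac] at hga
    rw [hpc, Function.update_self, hπ, hga, hgc, act_act_not]
  · rw [Function.update_of_ne hpc, hg p (hmem p hp), Function.update_of_ne hpc]

theorem mem_arrange {e : Bool} {x y p : Pass} : p ∈ arrange e x y ↔ p = x ∨ p = y := by
  cases e <;> simp [arrange, or_comm]

theorem arrange_perm (e : Bool) (x y : Pass) : (arrange e x y).Perm [x, y] := by
  cases e
  · exact List.Perm.swap _ _ _
  · exact List.Perm.refl _

theorem perm_interleave {α : Type*} (X Y Z u v w : List α) :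
    (X ++ u ++ Y ++ v ++ Z ++ w).Perm (X ++ Y ++ Z ++ (u ++ v ++ w)) := by
  classical
  rw [List.perm_iff_count]
  intro a
  simp only [List.count_append]
  omega

/-- The inverse move is the same move with all three order bits negated, and the sign conditions
survive because each involves two of these bits. So `runs_triangle` gives the correspondence of
colourings in both directions. -/
theorem lifts_triangle {π : Q → Q'} (hπ : Respects π) {a b c : ℕ} {o e₁ e₂ e₃ sa sb sc : Bool}
    (ha : sa = (o == (e₁ == e₂))) (hb : sb = (o == (e₁ == e₃))) {u v w : List Pass}
    (hw : NodupKeys (arrange e₁ ⟨a, true, sa⟩ ⟨b, true, sb⟩ ++ u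
      ++ arrange e₂ ⟨a, false, sa⟩ ⟨c, true, sc⟩ ++ v
      ++ arrange e₃ ⟨b, false, sb⟩ ⟨c, false, sc⟩ ++ w))
    (h : Lifts π (arrange e₁ ⟨a, true, sa⟩ ⟨b, true, sb⟩ ++ u
      ++ arrange e₂ ⟨a, false, sa⟩ ⟨c, true, sc⟩ ++ v
      ++ arrange e₃ ⟨b, false, sb⟩ ⟨c, false, sc⟩ ++ w)) :
    Lifts π (arrange (!e₁) ⟨a, true, sa⟩ ⟨b, true, sb⟩ ++ u
      ++ arrange (!e₂) ⟨a, false, sa⟩ ⟨c, true, sc⟩ ++ v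
      ++ arrange (!e₃) ⟨b, false, sb⟩ ⟨c, false, sc⟩ ++ w) := by
  have hperm := perm_interleave (arrange e₁ ⟨a, true, sa⟩ ⟨b, true, sb⟩)
    (arrange e₂ ⟨a, false, sa⟩ ⟨c, true, sc⟩) (arrange e₃ ⟨b, false, sb⟩ ⟨c, false, sc⟩) u v w
  have hc : ∀ p ∈ u ++ v ++ w, p.label ≠ c := label_ne_of_nodup hw hperm
    (by intro o; cases o <;> simp [mem_arrange])
  have hn : NodupKeys ([⟨a, true, sa⟩, ⟨b, true, sb⟩] ++ [⟨a, false, sa⟩, ⟨c, true, sc⟩]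
      ++ [⟨b, false, sb⟩, ⟨c, false, sc⟩] ++ (u ++ v ++ w)) := by
    refine (((hperm.trans (List.Perm.append_right _ ?_)).map _).nodup_iff).1 hw
    exact ((arrange_perm _ _ _).append (arrange_perm _ _ _)).append (arrange_perm _ _ _)
  have hac : a ≠ c := by rintro rfl; simp [NodupKeys] at hn
  have hbc : b ≠ c := by rintro rfl; simp [NodupKeys] at hn
  refine h.of_change hπ hac (σ := sa ^^ !e₂) ⟨⟨a, true, sa⟩, by simp [mem_arrange], rfl⟩
    ⟨⟨c, true, sc⟩, by simp [mem_arrange], rfl⟩ (by simp [mem_arrange]) ?_ ?_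
  · intro f x hx
    simp only [runs_append] at hx
    obtain ⟨z₅, ⟨z₄, ⟨z₃, ⟨z₂, ⟨z₁, h₁, hu⟩, h₂⟩, hv⟩, h₃⟩, hw⟩ := hx
    obtain ⟨k₁, k₂, k₃⟩ := runs_triangle (o := o) (by rw [ha, not_beq_not])
      (by rw [hb, not_beq_not]) hac hbc h₁ h₂ h₃
    simp only [Bool.not_not] at k₁ k₂ k₃
    simp only [runs_append]
    exact ⟨z₅, ⟨z₄, ⟨z₃, ⟨z₂, ⟨z₁, k₁, (runs_update fun p hp => hc p (by simp [hp])).2 hu⟩, k₂⟩,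
      (runs_update fun p hp => hc p (by simp [hp])).2 hv⟩, k₃⟩,
      (runs_update fun p hp => hc p (by simp [hp])).2 hw⟩
  · intro f x hx
    simp only [runs_append] at hx
    obtain ⟨z₅, ⟨z₄, ⟨z₃, ⟨z₂, ⟨z₁, h₁, hu⟩, h₂⟩, hv⟩, h₃⟩, hw⟩ := hx
    obtain ⟨k₁, k₂, k₃⟩ := runs_triangle ha hb hac hbc h₁ h₂ h₃
    have hσ : (!(sa ^^ !e₂)) = (sa ^^ e₂) := by cases sa <;> cases e₂ <;> rfl
    rw [hσ]
    simp only [runs_append]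
    exact ⟨z₅, ⟨z₄, ⟨z₃, ⟨z₂, ⟨z₁, k₁, (runs_update fun p hp => hc p (by simp [hp])).2 hu⟩, k₂⟩,
      (runs_update fun p hp => hc p (by simp [hp])).2 hv⟩, k₃⟩,
      (runs_update fun p hp => hc p (by simp [hp])).2 hw⟩

theorem lifts_triangle' {π : Q → Q'} (hπ : Respects π) {a b c : ℕ} {o e₁ e₂ e₃ sa sb sc : Bool}
    (ha : sa = (o == (e₁ == e₂))) (hb : sb = (o == (e₁ == e₃))) {u v w : List Pass}
    (hw : NodupKeys (arrange e₁ ⟨a, true, sa⟩ ⟨b, true, sb⟩ ++ u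
      ++ arrange e₃ ⟨b, false, sb⟩ ⟨c, false, sc⟩ ++ v
      ++ arrange e₂ ⟨a, false, sa⟩ ⟨c, true, sc⟩ ++ w))
    (h : Lifts π (arrange e₁ ⟨a, true, sa⟩ ⟨b, true, sb⟩ ++ u
      ++ arrange e₃ ⟨b, false, sb⟩ ⟨c, false, sc⟩ ++ v
      ++ arrange e₂ ⟨a, false, sa⟩ ⟨c, true, sc⟩ ++ w)) :
    Lifts π (arrange (!e₁) ⟨a, true, sa⟩ ⟨b, true, sb⟩ ++ u
      ++ arrange (!e₃) ⟨b, false, sb⟩ ⟨c, false, sc⟩ ++ v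
      ++ arrange (!e₂) ⟨a, false, sa⟩ ⟨c, true, sc⟩ ++ w) := by
  have hperm := perm_interleave (arrange e₁ ⟨a, true, sa⟩ ⟨b, true, sb⟩)
    (arrange e₃ ⟨b, false, sb⟩ ⟨c, false, sc⟩) (arrange e₂ ⟨a, false, sa⟩ ⟨c, true, sc⟩) u v w
  have hc : ∀ p ∈ u ++ v ++ w, p.label ≠ c := label_ne_of_nodup hw hperm
    (by intro o; cases o <;> simp [mem_arrange])
  have hn : NodupKeys ([⟨a, true, sa⟩, ⟨b, true, sb⟩] ++ [⟨b, false, sb⟩, ⟨c, false, sc⟩]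
      ++ [⟨a, false, sa⟩, ⟨c, true, sc⟩] ++ (u ++ v ++ w)) := by
    refine (((hperm.trans (List.Perm.append_right _ ?_)).map _).nodup_iff).1 hw
    exact ((arrange_perm _ _ _).append (arrange_perm _ _ _)).append (arrange_perm _ _ _)
  have hac : a ≠ c := by rintro rfl; simp [NodupKeys] at hn
  have hbc : b ≠ c := by rintro rfl; simp [NodupKeys] at hn
  refine h.of_change hπ hac (σ := sa ^^ !e₂) ⟨⟨a, true, sa⟩, by simp [mem_arrange], rfl⟩
    ⟨⟨c, true, sc⟩, by simp [mem_arrange], rfl⟩ (by simp [mem_arrange]) ?_ ?_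
  · intro f x hx
    simp only [runs_append] at hx
    obtain ⟨z₅, ⟨z₄, ⟨z₃, ⟨z₂, ⟨z₁, h₁, hu⟩, h₃⟩, hv⟩, h₂⟩, hw⟩ := hx
    obtain ⟨k₁, k₂, k₃⟩ := runs_triangle (o := o) (by rw [ha, not_beq_not])
      (by rw [hb, not_beq_not]) hac hbc h₁ h₂ h₃
    simp only [Bool.not_not] at k₁ k₂ k₃
    simp only [runs_append]
    exact ⟨z₅, ⟨z₄, ⟨z₃, ⟨z₂, ⟨z₁, k₁, (runs_update fun p hp => hc p (by simp [hp])).2 hu⟩, k₃⟩,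
      (runs_update fun p hp => hc p (by simp [hp])).2 hv⟩, k₂⟩,
      (runs_update fun p hp => hc p (by simp [hp])).2 hw⟩
  · intro f x hx
    simp only [runs_append] at hx
    obtain ⟨z₅, ⟨z₄, ⟨z₃, ⟨z₂, ⟨z₁, h₁, hu⟩, h₃⟩, hv⟩, h₂⟩, hw⟩ := hx
    obtain ⟨k₁, k₂, k₃⟩ := runs_triangle ha hb hac hbc h₁ h₂ h₃
    have hσ : (!(sa ^^ !e₂)) = (sa ^^ e₂) := by cases sa <;> cases e₂ <;> rfl
    rw [hσ]
    simp only [runs_append]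
    exact ⟨z₅, ⟨z₄, ⟨z₃, ⟨z₂, ⟨z₁, k₁, (runs_update fun p hp => hc p (by simp [hp])).2 hu⟩, k₃⟩,
      (runs_update fun p hp => hc p (by simp [hp])).2 hv⟩, k₂⟩,
      (runs_update fun p hp => hc p (by simp [hp])).2 hw⟩

theorem NodupKeys.reverse_triangle {X X' Y Y' Z Z' u v w : List Pass} (hX : X.Perm X')
    (hY : Y.Perm Y') (hZ : Z.Perm Z') (h : NodupKeys (X ++ u ++ Y ++ v ++ Z ++ w)) :
    NodupKeys (X' ++ u ++ Y' ++ v ++ Z' ++ w) :=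
  (((((((hX.append_right u).append hY).append_right v).append hZ).append_right w).map
    _).nodup_iff).1 h

theorem arrange_perm_not (e : Bool) (x y : Pass) : (arrange e x y).Perm (arrange (!e) x y) :=
  (arrange_perm e x y).trans (arrange_perm (!e) x y).symm

theorem Move.lifts_iff {π : Q → Q'} (hπ : Respects π) {w w' : List Pass} (h : Move w w')
    (hw : NodupKeys w) : Lifts π w ↔ Lifts π w' := by
  cases h with
  | rotate u v => exact ⟨fun h => h.rotate hπ, fun h => h.rotate hπ⟩
  | relabel σ => exact ⟨fun h => h.relabel σ, fun h => h.of_relabel⟩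
  | r1 a t s => exact lifts_kink_iff hw
  | r2 a b s e u v => exact lifts_clasp_iff hw
  | r3 a b c o e₁ e₂ e₃ sa sb sc u v w ha hb hc =>
    refine ⟨lifts_triangle hπ ha hb hw, fun h => ?_⟩
    simpa using lifts_triangle hπ (o := o) (e₁ := !e₁) (e₂ := !e₂) (e₃ := !e₃)
      (by rw [ha, not_beq_not]) (by rw [hb, not_beq_not])
      (hw.reverse_triangle (arrange_perm_not _ _ _) (arrange_perm_not _ _ _)
        (arrange_perm_not _ _ _)) h
  | r3' a b c o e₁ e₂ e₃ sa sb sc u v w ha hb hc =>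
    refine ⟨lifts_triangle' hπ ha hb hw, fun h => ?_⟩
    simpa using lifts_triangle' hπ (o := o) (e₁ := !e₁) (e₂ := !e₂) (e₃ := !e₃)
      (by rw [ha, not_beq_not]) (by rw [hb, not_beq_not])
      (hw.reverse_triangle (arrange_perm_not _ _ _) (arrange_perm_not _ _ _)
        (arrange_perm_not _ _ _)) h

theorem KnotDiagram.Equivalent.lifts_iff {π : Q → Q'} (hπ : Respects π) {D E : KnotDiagram}
    (h : D.Equivalent E) : Lifts π D.word ↔ Lifts π E.word := by
  induction h with
  | rel D E h => exact h.lifts_iff hπ D.nodup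
  | refl => exact Iff.rfl
  | symm _ _ _ ih => exact ih.symm
  | trans _ _ _ _ _ ih₁ ih₂ => exact ih₁.trans ih₂

end Colouring

/-! ### Fox colourings, their first-order deformations and the obstruction -/

section FoxColours

open SignedQuandle

variable {p : ℕ}

/-- The sign of a crossing. -/
def crossingSign (p : ℕ) (s : Bool) : ZMod p := if s then 1 else -1

/-- The colours of Fox: a strand of colour `x` continues as `2 * y - x` under a strand of
colour `y`. -/
instance : SignedQuandle (ZMod p) where
  act _ x y := 2 * y - x
  act_self _ x := by ring
  act_act_not _ x y := by ring
  act_act _ _ x y z := by ring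

/-- The module `𝔽_p[ε] / ε²`, over which the variable of the Alexander module acts as
multiplication by `-1 + ε`. -/
@[ext]
structure Jet (p : ℕ) where
  val : ZMod p
  slope : ZMod p

/-- The operation is `x ↦ t x + (1 - t) y` with `t = -1 + ε` at a positive crossing and with its
inverse `-1 - ε` at a negative one. -/
instance : SignedQuandle (Jet p) where
  act s x y := ⟨2 * y.val - x.val, 2 * y.slope - x.slope + crossingSign p s * (x.val - y.val)⟩
  act_self s x := by ext <;> simp <;> ring
  act_act_not s x y := by cases s <;> ext <;> simp [crossingSign] <;> ring
  act_act s t x y z := by cases s <;> cases t <;> ext <;> simp [crossingSign] <;> ring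

theorem zmod_act (s : Bool) (x y : ZMod p) : act s x y = 2 * y - x := rfl

@[simp] theorem Jet.act_val (s : Bool) (x y : Jet p) : (act s x y).val = 2 * y.val - x.val := rfl

@[simp] theorem Jet.act_slope (s : Bool) (x y : Jet p) :
    (act s x y).slope = 2 * y.slope - x.slope + crossingSign p s * (x.val - y.val) := rfl

/-- Modulo `ε` both `t` and `t⁻¹` become `-1`, which is why the Fox operation ignores the sign of
the crossing. -/
theorem Jet.respects_val : Respects (Jet.val : Jet p → ZMod p) := fun _ _ _ => rfl

/-- Follow a Fox colouring `f` and, along with it, a linear functional on the slopes of its lifts: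
`x` is the colour and `μ` the coefficient of the slope on the current edge, `m c` the coefficient
on the edge that runs into the lower passage of `c`, and `ω` the value of the functional that has
been accumulated. The result is `none` if the data are inconsistent. -/
def obstructionTrace (f m : ℕ → ZMod p) :
    List Pass → ZMod p → ZMod p → ZMod p → Option (ZMod p × ZMod p × ZMod p)
  | [], x, μ, ω => some (x, μ, ω)
  | q :: w, x, μ, ω =>
    if q.upper then
      if x = f q.label then obstructionTrace f m w x (μ + 2 * m q.label) ω else none
    else
      if μ = m q.label then
        obstructionTrace f m w (2 * f q.label - x) (-μ)
          (ω + crossingSign p q.pos * μ * (x - f q.label))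
      else none

theorem runs_of_obstructionTrace {f m : ℕ → ZMod p} {w : List Pass} {x μ ω x' μ' ω' : ZMod p}
    (h : obstructionTrace f m w x μ ω = some (x', μ', ω')) : Runs f x w x' := by
  induction w generalizing x μ ω with
  | nil => simp_all [obstructionTrace]
  | cons q w ih =>
    obtain ⟨a, o, s⟩ := q
    cases o
    · simp only [obstructionTrace, Bool.false_eq_true, if_false] at h
      split_ifs at h
      exact runs_under.2 (ih h)
    · simp only [obstructionTrace, if_true] at h
      split_ifs at h with hx
      exact runs_over.2 ⟨hx, ih h⟩

/-- The quantity `μ * slope + ω` is conserved up to terms `2 * m c * slope`, with the slope taken on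
the upper strand at `c`. At an under passage the term comes from `μ = m c` times the relation of the
crossing, at an over passage from the increment of `μ`, with opposite signs. -/
theorem obstructionTrace_slope {f m : ℕ → ZMod p} {w : List Pass} {x μ ω x' μ' ω' : ZMod p}
    (h : obstructionTrace f m w x μ ω = some (x', μ', ω')) {g : ℕ → Jet p} {y z : Jet p}
    (hg : ∀ q ∈ w, (g q.label).val = f q.label) (hy : y.val = x) (hr : Runs g y w z) :
    μ' * z.slope + ω'
        + ((w.filter fun q => !q.upper).map fun q => 2 * m q.label * (g q.label).slope).sum
      = μ * y.slope + ω
        + ((w.filter fun q => q.upper).map fun q => 2 * m q.label * (g q.label).slope).sum := by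
  induction w generalizing x μ ω y with
  | nil => simp_all [obstructionTrace]
  | cons q w ih =>
    have hq := hg q (by simp)
    obtain ⟨a, o, s⟩ := q
    cases o
    · simp only [obstructionTrace, Bool.false_eq_true, if_false] at h
      split_ifs at h with hm
      have := ih h (fun q hq => hg q (by simp [hq])) (by simp_all) (runs_under.1 hr)
      subst hm hy
      simp only at hq
      simp only [Jet.act_slope, hq] at this
      simp
      linear_combination this
    · simp only [obstructionTrace, if_true] at h
      split_ifs at h with hx
      obtain ⟨h₁, h₂⟩ := runs_over.1 hr
      have := ih h (fun q hq => hg q (by simp [hq])) hy h₂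
      simp [← h₁]
      linear_combination this

/-- A Fox colouring on which a consistent functional does not vanish has no lift. -/
theorem not_lifts_of_obstructionTrace {f m : ℕ → ZMod p} {w : List Pass} {x μ ω : ZMod p}
    (hw : ((w.filter fun q => !q.upper).map Pass.label).Perm
      ((w.filter fun q => q.upper).map Pass.label))
    (h : obstructionTrace f m w x μ 0 = some (x, μ, ω)) (hω : ω ≠ 0) :
    ¬ Lifts (Jet.val : Jet p → ZMod p) w := by
  intro hl
  obtain ⟨g, y, hg, hy, hr⟩ := hl f x (runs_of_obstructionTrace h)
  have key := obstructionTrace_slope h hg hy hr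
  -- Every crossing is passed once under and once over, so the two sums cancel; after a full turn
  -- only `ω = 0` remains.
  have hs := (hw.map fun a => 2 * m a * (g a).slope).sum_eq
  rw [List.map_map, List.map_map] at hs
  simp only [Function.comp_def] at hs
  rw [hs] at key
  exact hω (by linear_combination key)

/-- A certificate that a diagram has a Fox colouring without a lift. -/
def Obstructs (p : ℕ) (w : List Pass) (f : List (ZMod p)) (x : ZMod p) (m : List (ZMod p))
    (μ : ZMod p) : Bool :=
  decide (((w.filter fun q => !q.upper).map Pass.label).Perm
      ((w.filter fun q => q.upper).map Pass.label)) &&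
    match obstructionTrace (fun a => f.getD a 0) (fun a => m.getD a 0) w x μ 0 with
    | some (x', μ', ω) => decide (x' = x ∧ μ' = μ ∧ ω ≠ 0)
    | none => false

theorem not_lifts_of_obstructs {p : ℕ} {w : List Pass} {f m : List (ZMod p)} {x μ : ZMod p}
    (h : Obstructs p w f x m μ = true) : ¬ Lifts (Jet.val : Jet p → ZMod p) w := by
  simp only [Obstructs, Bool.and_eq_true, decide_eq_true_eq] at h
  obtain ⟨hw, h⟩ := h
  split at h
  · next x' μ' ω heq =>
    obtain ⟨rfl, rfl, hω⟩ := of_decide_eq_true h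
    exact not_lifts_of_obstructionTrace hw heq hω
  · simp at h

end FoxColours

/-! ### Cyclic words and colourings of edges -/

section CyclicWord

variable {Q : Type*} [SignedQuandle Q] {w : List Pass}

theorem NodupKeys.nodup (hw : NodupKeys w) : w.Nodup := List.Nodup.of_map _ hw

theorem NodupKeys.eq_of_mem (hw : NodupKeys w) {x y : Pass} (hx : x ∈ w) (hy : y ∈ w)
    (hl : x.label = y.label) (hu : x.upper = y.upper) : x = y :=
  List.inj_on_of_nodup_map hw hx hy (by rw [hl, hu])

theorem cyclicSucc_mem {x : Pass} (hx : x ∈ w) : cyclicSucc w x ∈ w := by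
  rw [cyclicSucc, dif_pos hx]
  exact List.next_mem _ _ _

theorem cyclicSucc_reverse_mem {x : Pass} (hx : x ∈ w) : cyclicSucc w.reverse x ∈ w :=
  List.mem_reverse.1 (cyclicSucc_mem (List.mem_reverse.2 hx))

theorem cyclicSucc_reverse_cyclicSucc (hw : w.Nodup) {x : Pass} (hx : x ∈ w) :
    cyclicSucc w.reverse (cyclicSucc w x) = x := by
  have h := cyclicSucc_mem hx
  rw [cyclicSucc, dif_pos (List.mem_reverse.2 h), List.next_reverse_eq_prev _ hw _ h]
  simp only [cyclicSucc, dif_pos hx]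
  exact List.prev_next _ hw _ _

theorem cyclicSucc_cyclicSucc_reverse (hw : w.Nodup) {x : Pass} (hx : x ∈ w) :
    cyclicSucc w (cyclicSucc w.reverse x) = x := by
  simpa using cyclicSucc_reverse_cyclicSucc (List.nodup_reverse.2 hw) (List.mem_reverse.2 hx)

theorem cyclicSucc_inj (hw : w.Nodup) {x y : Pass} (hx : x ∈ w) (hy : y ∈ w)
    (h : cyclicSucc w x = cyclicSucc w y) : x = y := by
  rw [← cyclicSucc_reverse_cyclicSucc hw hx, h, cyclicSucc_reverse_cyclicSucc hw hy]

theorem Consecutive.mem_left {x y : Pass} (h : Consecutive w x y) : x ∈ w := by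
  obtain ⟨u, hu⟩ := h
  exact hu.mem_iff.2 (by simp)

theorem Consecutive.mem_right {x y : Pass} (h : Consecutive w x y) : y ∈ w := by
  obtain ⟨u, hu⟩ := h
  exact hu.mem_iff.2 (by simp)

theorem Consecutive.cyclicSucc_eq {x y : Pass} (hw : w.Nodup) (h : Consecutive w x y) :
    cyclicSucc w x = y := by
  have hx := h.mem_left
  obtain ⟨u, hu⟩ := h
  rw [cyclicSucc, dif_pos hx, List.isRotated_next_eq hu hw]
  exact List.next_cons_cons_eq _ _ _ _

theorem cyclicSucc_getElem (hw : w.Nodup) (i : ℕ) (hi : i < w.length) :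
    cyclicSucc w w[i] = w[(i + 1) % w.length]'(Nat.mod_lt _ (by omega)) := by
  rw [cyclicSucc, dif_pos (List.getElem_mem hi)]
  exact List.next_getElem _ hw _ _

/-- What holds at one passage and is handed on to the next one holds everywhere. -/
theorem cyclic_induction (hw : w.Nodup) {C : Pass → Prop} {x₀ : Pass} (h₀ : x₀ ∈ w) (hC : C x₀)
    (hS : ∀ x ∈ w, C x → C (cyclicSucc w x)) : ∀ x ∈ w, C x := by
  obtain ⟨i, hi, rfl⟩ := List.getElem_of_mem h₀
  have hpos : 0 < w.length := by omega
  have key : ∀ k, C (w[(i + k) % w.length]'(Nat.mod_lt _ hpos)) := by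
    intro k
    induction k with
    | zero => simpa [Nat.mod_eq_of_lt hi] using hC
    | succ k ih =>
      have := hS _ (List.getElem_mem _) ih
      rw [cyclicSucc_getElem hw] at this
      simpa [← add_assoc] using this
  intro x hx
  obtain ⟨j, hj, rfl⟩ := List.getElem_of_mem hx
  -- This many steps lead from position `i` past the end of the word to position `j`.
  have := key (w.length - i + j)
  have hij : (i + (w.length - i + j)) % w.length = j := by
    rw [← add_assoc, Nat.add_sub_cancel' hi.le, Nat.add_mod_left, Nat.mod_eq_of_lt hj]
  simpa [hij] using this

theorem runs_iff_exists_states {f : ℕ → Q} {x y : Q} :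
    Runs f x w y ↔ ∃ h : ℕ → Q, h 0 = x ∧ h w.length = y ∧
      ∀ i (hi : i < w.length), Runs f (h i) [w[i]] (h (i + 1)) := by
  induction w generalizing x with
  | nil =>
    constructor
    · intro h
      exact ⟨fun _ => x, rfl, h, by simp⟩
    · rintro ⟨h, rfl, rfl, -⟩
      rfl
  | cons q w ih =>
    rw [show q :: w = [q] ++ w from rfl, runs_append]
    constructor
    · rintro ⟨z, hz, hr⟩
      obtain ⟨h, rfl, rfl, hh⟩ := ih.1 hr
      refine ⟨fun i => Nat.casesOn i x h, rfl, by simp, ?_⟩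
      rintro (_ | i) hi
      · simpa using hz
      · simpa using hh i (by simpa using hi)
    · rintro ⟨h, rfl, rfl, hh⟩
      refine ⟨h 1, by simpa using hh 0 (by simp), ih.2 ⟨fun i => h (i + 1), rfl, by simp, ?_⟩⟩
      intro i hi
      simpa using hh (i + 1) (by simpa using hi)

/-- Here `g q` is the colour of the edge that runs into `q`. In this form a colouring is a local
condition at each passage, without a base point. -/
theorem exists_edge_colours (hw : w.Nodup) {f : ℕ → Q} {x : Q} (h : Runs f x w x) :
    ∃ g : Pass → Q, (∀ hw : 0 < w.length, g w[0] = x) ∧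
      ∀ q ∈ w, Runs f (g q) [q] (g (cyclicSucc w q)) := by
  obtain ⟨h, h₀, h₁, hh⟩ := runs_iff_exists_states.1 h
  have hi : ∀ i (hi : i < w.length), w.idxOf w[i] = i := fun i hi => hw.idxOf_getElem i hi
  refine ⟨fun q => h (w.idxOf q), fun hpos => by simp only [hi, h₀], fun q hq => ?_⟩
  obtain ⟨i, hlt, rfl⟩ := List.getElem_of_mem hq
  rw [cyclicSucc_getElem hw]
  simp only [hi]
  convert hh i hlt using 1
  -- At the last passage the successor wraps around to position 0, where the run closes up.
  rcases Nat.lt_or_ge (i + 1) w.length with hlt' | hge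
  · rw [Nat.mod_eq_of_lt hlt']
  · have : i + 1 = w.length := by omega
    rw [this, Nat.mod_self, h₀, h₁]

theorem runs_of_edge_colours (hw : w.Nodup) {f : ℕ → Q} {g : Pass → Q}
    (hg : ∀ q ∈ w, Runs f (g q) [q] (g (cyclicSucc w q))) (hpos : 0 < w.length) :
    Runs f (g w[0]) w (g w[0]) := by
  refine runs_iff_exists_states.2
    ⟨fun i => g (w[i % w.length]'(Nat.mod_lt _ hpos)), by simp, by simp, fun i hi => ?_⟩
  have := hg _ (List.getElem_mem hi)
  rw [cyclicSucc_getElem hw] at this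
  simpa [Nat.mod_eq_of_lt hi] using this

end CyclicWord

/-! ### Matched diagrams as diagrams composed of twists -/

/-- The crossings of a word split into full twists of counter-directed strands: `m` exchanges the
two crossings of a twist, `s a` is the sign of the crossing `a`, and of the two passages through
`a` the one with `upper = o a` enters the twist while the other one leaves it. -/
structure TwistPairing (w : List Pass) where
  m : ℕ → ℕ
  o : ℕ → Bool
  s : ℕ → Bool
  nodup : NodupKeys w
  pos_eq : ∀ x ∈ w, x.pos = s x.label
  m_m : ∀ x ∈ w, m (m x.label) = x.label
  o_m : ∀ x ∈ w, o (m x.label) = o x.label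
  s_m : ∀ x ∈ w, s (m x.label) = s x.label
  enter_mem' : ∀ x ∈ w, ⟨x.label, o x.label, s x.label⟩ ∈ w
  leave_mem' : ∀ x ∈ w, ⟨x.label, !o x.label, s x.label⟩ ∈ w
  succ_enter' : ∀ x ∈ w, cyclicSucc w ⟨x.label, o x.label, s x.label⟩
    = ⟨m x.label, !o x.label, s x.label⟩

theorem KnotDiagram.IsMatched.exists_twistPairing {D : KnotDiagram} (hD : D.IsMatched) :
    Nonempty (TwistPairing D.word) := by
  obtain ⟨m, hm⟩ := hD
  have hn : NodupKeys D.word := D.nodup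
  let R : ℕ → Bool × Bool → Prop := fun a t =>
    Consecutive D.word ⟨a, t.1, t.2⟩ ⟨m a, !t.1, t.2⟩ ∧
      Consecutive D.word ⟨m a, t.1, t.2⟩ ⟨a, !t.1, t.2⟩
  have hR : ∀ x ∈ D.word, ∃ t, R x.label t := by
    intro x hx
    obtain ⟨-, o, s, h₁, h₂⟩ := (hm x hx).2
    exact ⟨(o, s), h₁, h₂⟩
  have hmem : ∀ x ∈ D.word, ∃ y ∈ D.word, y.label = m x.label := by
    intro x hx
    obtain ⟨t, h₁, h₂⟩ := hR x hx
    exact ⟨_, h₂.mem_left, rfl⟩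
  have hsymm : ∀ x ∈ D.word, ∀ t, R (m x.label) t → R x.label t := by
    intro x hx t h
    simp only [R, (hm x hx).1] at h
    exact ⟨h.2, h.1⟩
  have hmin : ∀ x ∈ D.word, ∃ t, R (min x.label (m x.label)) t := by
    intro x hx
    rcases min_choice x.label (m x.label) with h | h
    · rw [h]; exact hR x hx
    · obtain ⟨y, hy, hyl⟩ := hmem x hx
      rw [h, ← hyl]; exact hR y hy
  -- The bits are chosen once for each pair, from its smaller label, so that both crossings of the
  -- pair receive the same ones.
  let T : ℕ → Bool × Bool := fun a => Classical.epsilon (R (min a (m a)))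
  have hT : ∀ x ∈ D.word, R x.label (T x.label) := by
    intro x hx
    have h : R (min x.label (m x.label)) (T x.label) := Classical.epsilon_spec (hmin x hx)
    rcases min_choice x.label (m x.label) with h' | h'
    · rwa [h'] at h
    · rw [h'] at h; exact hsymm x hx _ h
  have hTm : ∀ x ∈ D.word, T (m x.label) = T x.label := by
    intro x hx
    simp only [T, (hm x hx).1, min_comm]
  have hleave : ∀ x ∈ D.word, (⟨x.label, !(T x.label).1, (T x.label).2⟩ : Pass) ∈ D.word :=
    fun x hx => (hT x hx).2.mem_right
  have henter : ∀ x ∈ D.word, (⟨x.label, (T x.label).1, (T x.label).2⟩ : Pass) ∈ D.word :=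
    fun x hx => (hT x hx).1.mem_left
  refine ⟨⟨m, fun a => (T a).1, fun a => (T a).2, hn, ?_, fun x hx => (hm x hx).1,
    fun x hx => by simp only [hTm x hx], fun x hx => by simp only [hTm x hx], henter, hleave,
    fun x hx => (hT x hx).1.cyclicSucc_eq hn.nodup⟩⟩
  intro x hx
  by_cases h : x.upper = (T x.label).1
  · exact congrArg Pass.pos (hn.eq_of_mem hx (henter x hx) rfl h)
  · exact congrArg Pass.pos (hn.eq_of_mem hx (hleave x hx) rfl (Bool.eq_not.2 h))

namespace TwistPairing

variable {w : List Pass} (M : TwistPairing w)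

/-- The labels of the crossings. -/
def labels (w : List Pass) : Finset ℕ := (w.map Pass.label).toFinset

theorem mem_labels {a : ℕ} : a ∈ labels w ↔ ∃ x ∈ w, x.label = a := by simp [labels]

/-- The passage through `a` that enters the twist. -/
def enter (a : ℕ) : Pass := ⟨a, M.o a, M.s a⟩

/-- The passage through `a` that leaves the twist. -/
def leave (a : ℕ) : Pass := ⟨a, !M.o a, M.s a⟩

/-- On which side of the strands the twist has its bigon: on the right if this is `true`. -/
def side (a : ℕ) : Bool := M.o a == M.s a

variable {M} {a b : ℕ}

theorem enter_mem (ha : a ∈ labels w) : M.enter a ∈ w := by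
  obtain ⟨x, hx, rfl⟩ := mem_labels.1 ha
  exact M.enter_mem' x hx

theorem leave_mem (ha : a ∈ labels w) : M.leave a ∈ w := by
  obtain ⟨x, hx, rfl⟩ := mem_labels.1 ha
  exact M.leave_mem' x hx

theorem m_mem (ha : a ∈ labels w) : M.m a ∈ labels w := by
  obtain ⟨x, hx, rfl⟩ := mem_labels.1 ha
  refine mem_labels.2 ⟨_, cyclicSucc_mem (M.enter_mem' x hx), ?_⟩
  rw [M.succ_enter' x hx]

theorem m_m_eq (ha : a ∈ labels w) : M.m (M.m a) = a := by
  obtain ⟨x, hx, rfl⟩ := mem_labels.1 ha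
  exact M.m_m x hx

theorem o_m_eq (ha : a ∈ labels w) : M.o (M.m a) = M.o a := by
  obtain ⟨x, hx, rfl⟩ := mem_labels.1 ha
  exact M.o_m x hx

theorem s_m_eq (ha : a ∈ labels w) : M.s (M.m a) = M.s a := by
  obtain ⟨x, hx, rfl⟩ := mem_labels.1 ha
  exact M.s_m x hx

theorem side_m_eq (ha : a ∈ labels w) : M.side (M.m a) = M.side a := by
  rw [side, o_m_eq ha, s_m_eq ha, side]

theorem succ_enter (ha : a ∈ labels w) : cyclicSucc w (M.enter a) = M.leave (M.m a) := by
  obtain ⟨x, hx, rfl⟩ := mem_labels.1 ha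
  rw [leave, o_m_eq ha, s_m_eq ha]
  exact M.succ_enter' x hx

theorem enter_ne_leave : M.enter a ≠ M.leave b := by
  intro h
  obtain rfl : a = b := congrArg Pass.label h
  simp [enter, leave] at h

theorem eq_enter_or_leave {x : Pass} (hx : x ∈ w) :
    x = M.enter x.label ∨ x = M.leave x.label := by
  have ha := mem_labels.2 ⟨x, hx, rfl⟩
  by_cases h : x.upper = M.o x.label
  · exact Or.inl (M.nodup.eq_of_mem hx (enter_mem ha) rfl h)
  · exact Or.inr (M.nodup.eq_of_mem hx (leave_mem ha) rfl (Bool.eq_not.2 h))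

/-- A leaving passage is the successor of an entrance, and the successor map is injective, so it
cannot also follow another leaving passage. Hence edges inside and outside the twists alternate
along the knot. -/
theorem exists_succ_leave (ha : a ∈ labels w) :
    ∃ b ∈ labels w, cyclicSucc w (M.leave a) = M.enter b := by
  have h := cyclicSucc_mem (leave_mem (M := M) ha)
  have hb := mem_labels.2 ⟨_, h, rfl⟩
  refine ⟨_, hb, (eq_enter_or_leave h).resolve_right fun h' => ?_⟩
  rw [← m_m_eq (M := M) hb, ← succ_enter (m_mem hb)] at h'
  exact enter_ne_leave (cyclicSucc_inj M.nodup.nodup (leave_mem ha) (enter_mem (m_mem hb)) h').symm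

/-- What holds at one entrance and is handed on through a twist to the next entrance holds at all
of them. -/
theorem twist_induction {C : ℕ → Prop} {a₀ : ℕ} (h₀ : a₀ ∈ labels w) (hC : C a₀)
    (hS : ∀ a ∈ labels w, ∀ b ∈ labels w,
      cyclicSucc w (M.leave (M.m a)) = M.enter b → C a → C b) :
    ∀ a ∈ labels w, C a := by
  -- The entrance `a` stands for both passages of the strand that enters there, `enter a` and `leave
  -- (m a)`.
  have key := cyclic_induction M.nodup.nodup
    (C := fun x => ∀ a ∈ labels w, x = M.enter a ∨ x = M.leave (M.m a) → C a)
    (enter_mem (M := M) h₀) ?_ ?_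
  · exact fun a ha => key _ (enter_mem (M := M) ha) a ha (Or.inl rfl)
  · rintro a ha (h | h)
    · obtain rfl : a₀ = a := congrArg Pass.label h
      exact hC
    · exact absurd h enter_ne_leave
  · rintro x hx ih a ha (h | h)
    · have hc := mem_labels.2 ⟨x, hx, rfl⟩
      rcases eq_enter_or_leave (M := M) hx with h' | h'
      · rw [h', succ_enter hc] at h
        exact absurd h.symm enter_ne_leave
      · have h'' : x = M.leave (M.m (M.m x.label)) := by rw [m_m_eq hc]; exact h'
        exact hS _ (m_mem hc) a ha (by rw [← h'', h]) (ih _ (m_mem hc) (Or.inr h''))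
    · rw [← succ_enter ha] at h
      exact ih a ha (Or.inl (cyclicSucc_inj M.nodup.nodup hx (enter_mem ha) h))

theorem length_eq (M : TwistPairing w) : w.length = 2 * (labels w).card := by
  have h : (w.map fun x => (x.label, x.upper)).toFinset = labels w ×ˢ Finset.univ := by
    ext ⟨a, t⟩
    simp only [List.mem_toFinset, List.mem_map, Finset.mem_product, Finset.mem_univ, and_true,
      mem_labels, Prod.mk.injEq]
    constructor
    · rintro ⟨x, hx, h, -⟩
      exact ⟨x, hx, h⟩
    · intro ha
      by_cases h : t = M.o a
      · exact ⟨_, enter_mem (M := M) (mem_labels.2 ha), rfl, h.symm⟩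
      · exact ⟨_, leave_mem (M := M) (mem_labels.2 ha), rfl, by
          revert h; cases t <;> cases h' : M.o a <;> simp [leave, h']⟩
  have h' := List.toFinset_card_of_nodup M.nodup
  rw [h, Finset.card_product, List.length_map] at h'
  simpa [mul_comm] using h'.symm


end TwistPairing

/-! ### Functions on the faces and their coordinates -/

namespace TwistPairing

variable {w : List Pass} {M : TwistPairing w} {a : ℕ} {F : Type*} {φ : Pass × Bool → F}

/-- A function on the directed edges that is constant on the faces. -/
def FaceInvariant (w : List Pass) (φ : Pass × Bool → F) : Prop :=
  ∀ d : Pass × Bool, d.1 ∈ w → φ (faceStep w d) = φ d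

/-- The value on the left of the edge that runs into the passage `x`. -/
def leftIn (w : List Pass) (φ : Pass × Bool → F) (x : Pass) : F := φ (cyclicSucc w.reverse x, true)

/-- The value on the right of the edge that runs into the passage `x`. -/
def rightIn (φ : Pass × Bool → F) (x : Pass) : F := φ (x, false)

theorem leftIn_succ (hw : w.Nodup) {x : Pass} (hx : x ∈ w) :
    leftIn w φ (cyclicSucc w x) = φ (x, true) := by
  rw [leftIn, cyclicSucc_reverse_cyclicSucc hw hx]

theorem flip_enter : (M.enter a).flip = M.leave a := rfl

theorem flip_leave : (M.leave a).flip = M.enter a := by simp [Pass.flip, enter, leave]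

theorem otherToLeft_enter : (M.enter a).otherToLeft = M.side a := rfl

theorem otherToLeft_leave : (M.leave a).otherToLeft = !M.side a := by
  simp only [Pass.otherToLeft, leave, side]
  cases M.o a <;> cases M.s a <;> rfl

/-- This lemma and the next three each turn one corner of a face at a twist; `side` decides which
way the walk continues on the other strand. -/
theorem leftIn_enter (hφ : FaceInvariant w φ) (ha : a ∈ labels w) :
    leftIn w φ (M.enter a) = φ (M.leave a, M.side a) := by
  have hn := M.nodup.nodup
  have h := hφ (cyclicSucc w.reverse (M.enter a), true) (cyclicSucc_reverse_mem (enter_mem ha))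
  rw [leftIn, ← h]
  simp [faceStep, cyclicSucc_cyclicSucc_reverse hn (enter_mem (M := M) ha), flip_enter,
    otherToLeft_enter]

theorem enter_true (hφ : FaceInvariant w φ) (ha : a ∈ labels w) :
    φ (M.enter a, true) = φ (M.enter (M.m a), !M.side a) := by
  rw [← hφ (M.enter a, true) (enter_mem ha)]
  simp [faceStep, succ_enter ha, flip_leave, otherToLeft_leave, side_m_eq ha]

theorem leave_false (hφ : FaceInvariant w φ) (ha : a ∈ labels w) :
    φ (M.leave (M.m a), false) = φ (M.leave a, !M.side a) := by
  have hn := M.nodup.nodup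
  rw [← hφ (M.leave (M.m a), false) (leave_mem (m_mem ha))]
  simp [faceStep, ← succ_enter ha, cyclicSucc_reverse_cyclicSucc hn (enter_mem (M := M) ha),
    flip_enter, otherToLeft_enter]

theorem rightIn_succ_leave (hφ : FaceInvariant w φ) (ha : a ∈ labels w) :
    rightIn φ (cyclicSucc w (M.leave a)) = φ (M.enter a, M.side a) := by
  have hn := M.nodup.nodup
  rw [rightIn, ← hφ (cyclicSucc w (M.leave a), false) (cyclicSucc_mem (leave_mem ha))]
  simp [faceStep, cyclicSucc_reverse_cyclicSucc hn (leave_mem (M := M) ha), flip_leave,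
    otherToLeft_leave]

theorem leftIn_succ_leave (ha : a ∈ labels w) :
    leftIn w φ (cyclicSucc w (M.leave a)) = φ (M.leave a, true) :=
  leftIn_succ M.nodup.nodup (leave_mem ha)

/-- If the bigon is on the right, the left face changes along the twist and the right one does
not. -/
theorem faces_of_side (hφ : FaceInvariant w φ) (ha : a ∈ labels w) (hs : M.side a = true) :
    leftIn w φ (cyclicSucc w (M.leave a)) = leftIn w φ (M.enter a) ∧
      rightIn φ (cyclicSucc w (M.leave a)) = rightIn φ (M.enter (M.m a)) ∧
      φ (M.leave (M.m a), false) = φ (M.leave a, false) := by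
  refine ⟨?_, ?_, ?_⟩
  · rw [leftIn_succ_leave ha, leftIn_enter hφ ha, hs]
  · rw [rightIn_succ_leave hφ ha, hs, enter_true hφ ha, hs]
    rfl
  · rw [leave_false hφ ha, hs]
    rfl

/-- If the bigon is on the left, the right face changes along the twist and the left one does
not. -/
theorem faces_of_not_side (hφ : FaceInvariant w φ) (ha : a ∈ labels w) (hs : M.side a = false) :
    leftIn w φ (cyclicSucc w (M.leave a)) = leftIn w φ (M.enter (M.m a)) ∧
      rightIn φ (cyclicSucc w (M.leave a)) = rightIn φ (M.enter a) ∧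
      φ (M.enter (M.m a), true) = φ (M.enter a, true) := by
  refine ⟨?_, ?_, ?_⟩
  · rw [leftIn_succ_leave ha, leftIn_enter hφ (m_mem ha), side_m_eq ha, hs, leave_false hφ ha, hs]
    rfl
  · rw [rightIn_succ_leave hφ ha, hs]
    rfl
  · rw [enter_true hφ ha, hs]
    rfl

section LinearAlgebra

variable {K : Type*} [Field K]

open Classical in
/-- The value at a directed edge, as a linear form on the functions on the faces. -/
noncomputable def evalDart (K : Type*) [Field K] (w : List Pass) (d : Pass × Bool) :
    (Faces w → K) →ₗ[K] K :=
  if h : d.1 ∈ w then LinearMap.proj (Quot.mk _ ⟨d, h⟩ : Faces w) else 0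

theorem evalDart_apply {d : Pass × Bool} (h : d.1 ∈ w) (Φ : Faces w → K) :
    evalDart K w d Φ = Φ (Quot.mk _ ⟨d, h⟩) := by
  rw [evalDart, dif_pos h]
  rfl

theorem faceStep_mem (hc : ∀ x ∈ w, x.flip ∈ w) {d : Pass × Bool} (h : d.1 ∈ w) :
    (faceStep w d).1 ∈ w := by
  obtain ⟨x, b⟩ := d
  cases b
  · exact hc _ (cyclicSucc_reverse_mem h)
  · exact hc _ (cyclicSucc_mem h)

theorem faceInvariant_evalDart (hc : ∀ x ∈ w, x.flip ∈ w) (Φ : Faces w → K) :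
    FaceInvariant w fun d => evalDart K w d Φ := by
  intro d h
  simp only
  rw [evalDart_apply h, evalDart_apply (faceStep_mem hc h)]
  refine congrArg Φ (Eq.symm ?_)
  exact Quot.sound (r := fun d e : Dart w => faceStep w d.1 = e.1) rfl

/-- The coordinate of a function on the faces that belongs to the crossing `a`: the change along
the twist plus the value at the bigon. -/
noncomputable def twistCoord (K : Type*) [Field K] (M : TwistPairing w) (a : ℕ) :
    (Faces w → K) →ₗ[K] K :=
  if M.side a then
    evalDart K w (cyclicSucc w.reverse (M.enter (M.m a)), true)
      - evalDart K w (cyclicSucc w.reverse (M.enter a), true) + evalDart K w (M.leave a, false)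
  else
    evalDart K w (M.enter (M.m a), false) - evalDart K w (M.enter a, false)
      + evalDart K w (M.enter a, true)

/-- Coordinates on the space of functions on the faces. -/
noncomputable def faceCoords (K : Type*) [Field K] (M : TwistPairing w) (a₀ : ℕ) :
    (Faces w → K) →ₗ[K] K × K × (labels w → K) :=
  (evalDart K w (cyclicSucc w.reverse (M.enter a₀), true)).prod
    ((evalDart K w (M.enter a₀, false)).prod (LinearMap.pi fun a => twistCoord K M a))

theorem faceCoords_apply {a₀ : ℕ} (Φ : Faces w → K) :
    faceCoords K M a₀ Φ = (evalDart K w (cyclicSucc w.reverse (M.enter a₀), true) Φ,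
      evalDart K w (M.enter a₀, false) Φ, fun a : labels w => twistCoord K M a Φ) := rfl

/-- The two coordinates of a twist determine the change of the faces along the twist. -/
theorem jump_of_twistCoord (h2 : (2 : K) ≠ 0) (hc : ∀ x ∈ w, x.flip ∈ w) {Φ : Faces w → K} {J : K}
    (ha : a ∈ labels w) (h : twistCoord K M a Φ = J) (h' : twistCoord K M (M.m a) Φ = -J) :
    (M.side a = true → evalDart K w (M.leave a, false) Φ = 0 ∧
      leftIn w (fun d => evalDart K w d Φ) (M.enter (M.m a))
        = leftIn w (fun d => evalDart K w d Φ) (M.enter a) + J) ∧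
    (M.side a = false → evalDart K w (M.enter a, true) Φ = 0 ∧
      rightIn (fun d => evalDart K w d Φ) (M.enter (M.m a))
        = rightIn (fun d => evalDart K w d Φ) (M.enter a) + J) := by
  have hφ := faceInvariant_evalDart hc Φ
  constructor
  · intro hs
    obtain ⟨-, -, hb⟩ := faces_of_side hφ ha hs
    simp only [twistCoord, side_m_eq ha, m_m_eq ha, hs, if_true, LinearMap.add_apply,
      LinearMap.sub_apply] at h h'
    simp only [leftIn]
    -- Exchanging the two crossings of the twist negates the change and keeps the value at the
    -- bigon, so the two coordinates add up to twice that value.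
    have h0 : evalDart K w (M.leave a, false) Φ = 0 := by
      refine (mul_eq_zero.1 ?_).resolve_left h2
      linear_combination h + h' - hb
    exact ⟨h0, by linear_combination h - h0⟩
  · intro hs
    obtain ⟨-, -, hb⟩ := faces_of_not_side hφ ha hs
    simp only [twistCoord, side_m_eq ha, m_m_eq ha, hs, Bool.false_eq_true, if_false,
      LinearMap.add_apply, LinearMap.sub_apply] at h h'
    simp only [rightIn]
    have h0 : evalDart K w (M.enter a, true) Φ = 0 := by
      refine (mul_eq_zero.1 ?_).resolve_left h2
      linear_combination h + h' - hb
    exact ⟨h0, by linear_combination h - h0⟩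

/-- If all coordinates vanish, then every bigon has value 0 and no face value changes along a twist.
The two zeros beside the edge into `enter a₀` are therefore carried along the whole knot. -/
theorem faceCoords_injective (h2 : (2 : K) ≠ 0) (hc : ∀ x ∈ w, x.flip ∈ w) {a₀ : ℕ}
    (h₀ : a₀ ∈ labels w) : Function.Injective (faceCoords K M a₀) := by
  rw [← LinearMap.ker_eq_bot, LinearMap.ker_eq_bot']
  intro Φ hΦ
  have hφ := faceInvariant_evalDart hc Φ
  set φ : Pass × Bool → K := fun d => evalDart K w d Φ
  simp only [faceCoords_apply, Prod.mk_eq_zero, funext_iff, Pi.zero_apply, Subtype.forall] at hΦ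
  obtain ⟨hL, hR, hT⟩ := hΦ
  have hJ := fun a (ha : a ∈ labels w) =>
    jump_of_twistCoord (M := M) h2 hc (J := 0) ha (hT a ha) (by simpa using hT _ (m_mem ha))
  have hout : ∀ a ∈ labels w,
      leftIn w φ (cyclicSucc w (M.leave (M.m a))) = leftIn w φ (M.enter a) ∧
      rightIn φ (cyclicSucc w (M.leave (M.m a))) = rightIn φ (M.enter a) := by
    intro a ha
    cases hs : M.side a
    · obtain ⟨h₁, h₂, -⟩ := faces_of_not_side hφ (m_mem ha) ((side_m_eq ha).trans hs)
      rw [m_m_eq ha] at h₁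
      exact ⟨h₁, by simpa using h₂.trans ((hJ a ha).2 hs).2⟩
    · obtain ⟨h₁, h₂, -⟩ := faces_of_side hφ (m_mem ha) ((side_m_eq ha).trans hs)
      rw [m_m_eq ha] at h₂
      exact ⟨by simpa using h₁.trans ((hJ a ha).1 hs).2, h₂⟩
  have hin : ∀ a ∈ labels w, leftIn w φ (M.enter a) = 0 ∧ rightIn φ (M.enter a) = 0 := by
    refine twist_induction (M := M) h₀ ⟨hL, hR⟩ fun a ha b _ hab h => ?_
    rw [← hab, (hout a ha).1, (hout a ha).2]
    exact h
  -- A directed edge outside the twists is covered by `hin` and `hout`. One inside a twist borders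
  -- either the bigon or a face that also borders an edge outside.
  have hzero : ∀ d : Pass × Bool, d.1 ∈ w → φ d = 0 := by
    rintro ⟨x, t⟩ hx
    simp only at hx
    have ha := mem_labels.2 ⟨x, hx, rfl⟩
    have hma := m_mem (M := M) ha
    have hout' := hout _ hma
    rw [m_m_eq ha, (hin _ hma).1, (hin _ hma).2] at hout'
    rcases eq_enter_or_leave (M := M) hx with h | h <;> rw [h]
    · cases t
      · exact (hin _ ha).2
      · cases hs : M.side x.label
        · exact ((hJ _ ha).2 hs).1
        · rw [← hs, ← rightIn_succ_leave hφ ha]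
          exact hout'.2
    · cases t
      · cases hs : M.side x.label
        · rw [← hs, ← leftIn_enter hφ ha]
          exact (hin _ ha).1
        · exact ((hJ _ ha).1 hs).1
      · exact (leftIn_succ_leave ha).symm.trans hout'.1
  funext q
  induction q using Quot.ind with | _ d => ?_
  exact (evalDart_apply d.2 Φ).symm.trans (hzero d.1 d.2)

instance finite_dart : Finite (Dart w) :=
  Finite.of_injective (β := {x // x ∈ w} × Bool) (fun d => (⟨d.1.1, d.2⟩, d.1.2)) (by
    rintro ⟨⟨x, s⟩, hx⟩ ⟨⟨y, t⟩, hy⟩ h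
    simpa using h)

/-- On the sphere the coordinates of a function on the faces can be prescribed. -/
theorem faceCoords_surjective (h2 : (2 : K) ≠ 0) (hc : ∀ x ∈ w, x.flip ∈ w)
    (hw : 2 * Nat.card (Faces w) = w.length + 4) {a₀ : ℕ} (h₀ : a₀ ∈ labels w) :
    Function.Surjective (faceCoords K M a₀) := by
  have : Fintype (Faces w) := Fintype.ofFinite _
  refine (LinearMap.injective_iff_surjective_of_finrank_eq_finrank ?_).1
    (faceCoords_injective h2 hc h₀)
  -- With `n` crossings there are `n + 2` faces, and the coordinates number `1 + 1 + n`.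
  rw [M.length_eq, Nat.card_eq_fintype_card] at hw
  simp only [Module.finrank_prod, Module.finrank_fintype_fun_eq_card, Module.finrank_self,
    Fintype.card_coe]
  omega

end LinearAlgebra

end TwistPairing

/-! ### Lifting the Fox colourings of a matched diagram -/

namespace TwistPairing

variable {w : List Pass} {M : TwistPairing w} {a : ℕ} {p : ℕ}

/-- The Fox colours at a twist. -/
theorem fox_twist {f : ℕ → ZMod p} {g : Pass → ZMod p}
    (hg : ∀ q ∈ w, Runs f (g q) [q] (g (cyclicSucc w q))) (ha : a ∈ labels w) :
    (M.o a = true → f a = g (M.enter a) ∧ g (M.leave a) = g (M.enter (M.m a)) ∧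
      g (cyclicSucc w (M.leave a)) = 2 * g (M.enter a) - g (M.enter (M.m a))) ∧
    (M.o a = false → g (cyclicSucc w (M.leave a)) = f a ∧ g (M.leave a) = f a ∧
      f (M.m a) = 2 * f a - g (M.enter a)) := by
  have h₁ := hg _ (enter_mem (M := M) ha)
  have h₂ := hg _ (leave_mem (M := M) ha)
  have h₃ := hg _ (enter_mem (M := M) (m_mem (M := M) ha))
  have h₄ := hg _ (leave_mem (M := M) (m_mem (M := M) ha))
  rw [succ_enter ha] at h₁
  rw [succ_enter (m_mem ha), m_m_eq ha] at h₃
  constructor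
  · intro ho
    simp only [enter, leave, o_m_eq ha, ho, Bool.not_true, runs_over, runs_under, runs_nil,
      zmod_act] at h₁ h₂ h₃ h₄ ⊢
    refine ⟨h₁.1.symm, h₃.2.symm, ?_⟩
    rw [← h₂, ← h₃.2, ← h₁.1]
  · intro ho
    simp only [enter, leave, o_m_eq ha, ho, Bool.not_false, runs_over, runs_under, runs_nil,
      zmod_act] at h₁ h₂ h₃ h₄ ⊢
    exact ⟨h₂.2.symm.trans h₂.1, h₂.1, h₄.1.symm.trans h₁.symm⟩

/-- A Fox colouring of a spherical diagram that consists of twists is the sum of a function of the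
left face and the same function of the right face, as far as the edges outside of the twists are
concerned. -/
theorem exists_face_function [Fact p.Prime] (h2 : (2 : ZMod p) ≠ 0) (hc : ∀ x ∈ w, x.flip ∈ w)
    (hw : 2 * Nat.card (Faces w) = w.length + 4) (hne : w ≠ []) {f : ℕ → ZMod p}
    {g : Pass → ZMod p} (hg : ∀ q ∈ w, Runs f (g q) [q] (g (cyclicSucc w q))) :
    ∃ φ : Pass × Bool → ZMod p, FaceInvariant w φ ∧
      ∀ a ∈ labels w, g (M.enter a) = leftIn w φ (M.enter a) + rightIn φ (M.enter a) := by
  obtain ⟨x₀, hx₀⟩ := List.exists_mem_of_ne_nil _ hne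
  have h₀ : x₀.label ∈ labels w := mem_labels.2 ⟨x₀, hx₀, rfl⟩
  -- The change of the Fox colour along the strand that enters at `a`; it is opposite for the two
  -- strands of a twist.
  let J : ℕ → ZMod p := fun a => g (cyclicSucc w (M.leave (M.m a))) - g (M.enter a)
  have hJ : ∀ a ∈ labels w, J (M.m a) = -J a := by
    intro a ha
    obtain ⟨h₁, h₂⟩ := fox_twist (M := M) hg ha
    obtain ⟨h₁', h₂'⟩ := fox_twist (M := M) hg (m_mem (M := M) ha)
    simp only [J, m_m_eq ha]
    rw [m_m_eq ha, o_m_eq ha] at h₁' h₂'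
    cases ho : M.o a
    · obtain ⟨k₁, -, k₂⟩ := h₂ ho
      obtain ⟨k₃, -, k₄⟩ := h₂' ho
      linear_combination k₁ + k₃ - k₂ - k₄
    · obtain ⟨-, -, k₁⟩ := h₁ ho
      obtain ⟨-, -, k₂⟩ := h₁' ho
      linear_combination k₁ + k₂
  -- Prescribing `J` at both crossings of a twist makes the bigon vanish, by `jump_of_twistCoord`.
  -- How the colour of the initial edge is split between its two faces is arbitrary; all of it goes
  -- to the left.
  obtain ⟨Φ, hΦ⟩ := faceCoords_surjective (K := ZMod p) (M := M) h2 hc hw h₀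
    (g (M.enter x₀.label), 0, fun a => J a)
  have hφ := faceInvariant_evalDart hc Φ
  refine ⟨_, hφ, ?_⟩
  set φ : Pass × Bool → ZMod p := fun d => evalDart (ZMod p) w d Φ
  simp only [faceCoords_apply, Prod.mk.injEq, funext_iff, Subtype.forall] at hΦ
  obtain ⟨hL, hR, hT⟩ := hΦ
  refine twist_induction (M := M) h₀ ?_ fun a ha b _ hab h => ?_
  · simp only [leftIn, rightIn, φ, hL, hR, add_zero]
  · obtain ⟨j₁, j₂⟩ := jump_of_twistCoord (M := M) h2 hc ha (hT a ha)
      ((hT _ (m_mem ha)).trans (hJ a ha))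
    have hb : g (M.enter b) = g (M.enter a) + J a := by simp only [J, hab]; ring
    cases hs : M.side a
    · obtain ⟨k₁, k₂, -⟩ := faces_of_not_side hφ (m_mem ha) ((side_m_eq ha).trans hs)
      rw [m_m_eq ha, hab] at k₁
      rw [hab] at k₂
      rw [hb, h, k₁, k₂, (j₂ hs).2]
      ring
    · obtain ⟨k₁, k₂, -⟩ := faces_of_side hφ (m_mem ha) ((side_m_eq ha).trans hs)
      rw [m_m_eq ha, hab] at k₂
      rw [hab] at k₁
      rw [hb, h, k₁, k₂, (j₁ hs).2]
      ring

/-- The slopes of the lifted colouring are a multiple of the difference of the two faces. -/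
theorem slope_twist {κ : ZMod p} (hκ : 4 * κ = -1) {f : ℕ → ZMod p} {g : Pass → ZMod p}
    (hg : ∀ q ∈ w, Runs f (g q) [q] (g (cyclicSucc w q))) {φ : Pass × Bool → ZMod p}
    (hφ : FaceInvariant w φ)
    (hsum : ∀ a ∈ labels w, g (M.enter a) = leftIn w φ (M.enter a) + rightIn φ (M.enter a))
    {δ : Pass → ZMod p} (hδ : ∀ x, δ x = κ * (rightIn φ x - leftIn w φ x)) (ha : a ∈ labels w) :
    (M.o a = true → δ (cyclicSucc w (M.leave a)) = 2 * δ (M.enter a) - δ (M.enter (M.m a))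
      + crossingSign p (M.s a) * (g (M.enter (M.m a)) - g (M.enter a))) ∧
    (M.o a = false → δ (cyclicSucc w (M.leave (M.m a))) = 2 * δ (cyclicSucc w (M.leave a))
      - δ (M.enter a) + crossingSign p (M.s a) * (g (M.enter a) - f a)) := by
  have hma := m_mem (M := M) ha
  obtain ⟨f₁, f₂⟩ := fox_twist (M := M) hg ha
  obtain ⟨f₃, f₄⟩ := fox_twist (M := M) hg hma
  have hout : g (cyclicSucc w (M.leave a))
      = leftIn w φ (cyclicSucc w (M.leave a)) + rightIn φ (cyclicSucc w (M.leave a)) := by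
    obtain ⟨b, hb, hab⟩ := exists_succ_leave (M := M) ha
    rw [hab]
    exact hsum b hb
  have h₁ := hsum a ha
  have h₂ := hsum _ hma
  simp only [hδ]
  rw [m_m_eq ha, o_m_eq ha] at f₃ f₄
  set L := leftIn w φ (M.enter a)
  set R := rightIn φ (M.enter a)
  set L' := leftIn w φ (M.enter (M.m a))
  set R' := rightIn φ (M.enter (M.m a))
  -- The side of the bigon and the bit `o` fix the sign of the twist, which leaves four cases. In
  -- each, the Fox relations make one of `L' - L`, `R' - R` twice the other up to sign (`hJ`), and
  -- what remains of the slope relation is a multiple of `4 * κ = -1`.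
  cases hs : M.side a
  · obtain ⟨k₁, k₂, -⟩ := faces_of_not_side hφ ha hs
    obtain ⟨k₃, k₄, -⟩ := faces_of_not_side hφ hma ((side_m_eq ha).trans hs)
    rw [m_m_eq ha] at k₃
    rw [k₁, k₂, k₃, k₄]
    rw [k₁, k₂] at hout
    constructor <;> intro ho
    · have hsa : M.s a = false := by simpa [side, ho] using hs
      obtain ⟨-, -, q⟩ := f₁ ho
      simp only [crossingSign, hsa, Bool.false_eq_true, if_false]
      have hJ : R' - R + 2 * (L' - L) = 0 := by linear_combination q - hout + 2 * h₁ - h₂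
      linear_combination -(L' - L) * hκ + (κ + 1) * hJ + h₂ - h₁
    · have hsa : M.s a = true := by simpa [side, ho] using hs
      obtain ⟨q₁, -, q₂⟩ := f₂ ho
      obtain ⟨q₃, -, q₄⟩ := f₄ ho
      simp only [crossingSign, hsa, if_true]
      have hJ : R - R' + 2 * (L' - L) = 0 := by
        linear_combination -(q₄ + 2 * q₂) - 3 * hout + 3 * q₁ + 2 * h₁ + h₂
      linear_combination (L' - L) * hκ - κ * hJ - h₁ + hout - q₁
  · obtain ⟨k₁, k₂, -⟩ := faces_of_side hφ ha hs
    obtain ⟨k₃, k₄, -⟩ := faces_of_side hφ hma ((side_m_eq ha).trans hs)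
    rw [m_m_eq ha] at k₄
    rw [k₁, k₂, k₃, k₄]
    rw [k₁, k₂] at hout
    constructor <;> intro ho
    · have hsa : M.s a = true := by simpa [side, ho] using hs
      obtain ⟨-, -, q⟩ := f₁ ho
      simp only [crossingSign, hsa, if_true]
      have hJ : L' - L + 2 * (R' - R) = 0 := by linear_combination q - hout + 2 * h₁ - h₂
      linear_combination (R' - R) * hκ - (κ + 1) * hJ - h₂ + h₁
    · have hsa : M.s a = false := by simpa [side, ho] using hs
      obtain ⟨q₁, -, q₂⟩ := f₂ ho
      obtain ⟨q₃, -, q₄⟩ := f₄ ho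
      simp only [crossingSign, hsa, Bool.false_eq_true, if_false]
      have hJ : L - L' + 2 * (R' - R) = 0 := by
        linear_combination -(q₄ + 2 * q₂) - 3 * hout + 3 * q₁ + 2 * h₁ + h₂
      linear_combination -(R' - R) * hκ + κ * hJ + h₁ - hout + q₁

theorem lifts [Fact p.Prime] (h2 : (2 : ZMod p) ≠ 0) (M : TwistPairing w)
    (hc : ∀ x ∈ w, x.flip ∈ w) (hw : 2 * Nat.card (Faces w) = w.length + 4) (hne : w ≠ []) :
    Lifts (Jet.val : Jet p → ZMod p) w := by
  intro f x hx
  have hn := M.nodup.nodup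
  obtain ⟨g, hgx, hg⟩ := exists_edge_colours hn hx
  obtain ⟨φ, hφ, hsum⟩ := exists_face_function (M := M) h2 hc hw hne hg
  have hκ : 4 * (-(2 * 2)⁻¹ : ZMod p) = -1 := by field_simp; ring
  set κ : ZMod p := -(2 * 2)⁻¹
  let δ : Pass → ZMod p := fun x => κ * (rightIn φ x - leftIn w φ x)
  have hslope := fun a (ha : a ∈ labels w) =>
    slope_twist (M := M) hκ hg hφ hsum (δ := δ) (fun _ => rfl) ha
  -- Outside the twists the slope is `δ`. An edge inside a twist is part of the same arc as its
  -- outer neighbour across the over passage and takes its slope from there: from the incoming edge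
  -- if the strands enter over, from the outgoing edge otherwise.
  let f' : ℕ → Jet p := fun a =>
    ⟨f a, if M.o a then δ (M.enter a) else δ (cyclicSucc w (M.leave a))⟩
  let g' : Pass → Jet p := fun x =>
    ⟨g x, if x.upper = M.o x.label then δ x else if M.o x.label then δ (M.enter (M.m x.label))
      else δ (cyclicSucc w (M.leave x.label))⟩
  have hpos : 0 < w.length := List.length_pos_iff.2 hne
  refine ⟨f', g' w[0], fun _ _ => rfl, hgx hpos, runs_of_edge_colours hn ?_ hpos⟩
  have henter : ∀ a, g' (M.enter a) = ⟨g (M.enter a), δ (M.enter a)⟩ := fun a => by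
    simp [g', enter]
  have hleave : ∀ a, g' (M.leave a) = ⟨g (M.leave a), if M.o a then δ (M.enter (M.m a))
      else δ (cyclicSucc w (M.leave a))⟩ := fun a => by
    simp [g', leave]
  have key : ∀ a ∈ labels w,
      Runs f' (g' (M.enter a)) [M.enter a] (g' (cyclicSucc w (M.enter a))) ∧
      Runs f' (g' (M.leave a)) [M.leave a] (g' (cyclicSucc w (M.leave a))) := by
    intro a ha
    obtain ⟨f₁, f₂⟩ := fox_twist (M := M) hg ha
    obtain ⟨f₃, f₄⟩ := fox_twist (M := M) hg (m_mem (M := M) ha)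
    rw [m_m_eq ha, o_m_eq ha] at f₃ f₄
    obtain ⟨s₁, s₂⟩ := hslope _ ha
    obtain ⟨b, -, hab⟩ := exists_succ_leave (M := M) ha
    have hr₁ : g' (cyclicSucc w (M.leave a))
        = ⟨g (cyclicSucc w (M.leave a)), δ (cyclicSucc w (M.leave a))⟩ := by
      rw [hab, henter]
    rw [succ_enter ha, hr₁, henter, hleave, hleave, m_m_eq ha, o_m_eq ha]
    cases ho : M.o a
    · obtain ⟨k₁, k₂, k₃⟩ := f₂ ho
      obtain ⟨k₄, k₅, k₆⟩ := f₄ ho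
      have he : M.enter a = ⟨a, false, M.s a⟩ := by rw [enter, ho]
      have hl : M.leave a = ⟨a, true, M.s a⟩ := by rw [leave, ho]; rfl
      constructor
      · nth_rw 3 [he]
        refine runs_under.2 (runs_nil.2 (Jet.ext ?_ ?_))
        · simp [f', k₅, k₃]
        · simp [f', ho, s₂ ho]
      · nth_rw 3 [hl]
        refine runs_over.2 ⟨Jet.ext ?_ ?_, runs_nil.2 (Jet.ext ?_ ?_)⟩ <;> simp [f', ho, k₁, k₂]
    · obtain ⟨k₁, k₂, k₃⟩ := f₁ ho
      obtain ⟨k₄, k₅, k₆⟩ := f₃ ho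
      have he : M.enter a = ⟨a, true, M.s a⟩ := by rw [enter, ho]
      have hl : M.leave a = ⟨a, false, M.s a⟩ := by rw [leave, ho]; rfl
      constructor
      · nth_rw 3 [he]
        refine runs_over.2 ⟨Jet.ext ?_ ?_, runs_nil.2 (Jet.ext ?_ ?_)⟩ <;> simp [f', ho, k₁, k₅]
      · nth_rw 3 [hl]
        refine runs_under.2 (runs_nil.2 (Jet.ext ?_ ?_))
        · simp [f', k₁, k₂, k₃]
        · simp [f', ho, s₁ ho, k₁, k₂]
  intro q hq
  have ha := mem_labels.2 ⟨q, hq, rfl⟩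
  rcases eq_enter_or_leave (M := M) hq with h | h
  · rw [h]
    exact (key _ ha).1
  · rw [h]
    exact (key _ ha).2

end TwistPairing

/-! ### The criterion for bipartite knots and the certificates -/

theorem KnotDiagram.IsMatched.lifts {p : ℕ} [Fact p.Prime] (h2 : (2 : ZMod p) ≠ 0)
    {D : KnotDiagram} (hD : D.IsMatched) : Lifts (Jet.val : Jet p → ZMod p) D.word := by
  obtain ⟨M⟩ := hD.exists_twistPairing
  by_cases hne : D.word = []
  · rw [hne]
    -- A circle without crossings imposes no relation, so slope 0 serves as a lift.
    exact fun f x _ => ⟨fun a => ⟨f a, 0⟩, ⟨x, 0⟩, by simp, rfl, rfl⟩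
  · exact M.lifts h2 D.closed (D.spherical.resolve_left hne) hne

theorem KnotDiagram.not_isBipartite {p : ℕ} [Fact p.Prime] (h2 : (2 : ZMod p) ≠ 0)
    {D : KnotDiagram} (h : ¬ Lifts (Jet.val : Jet p → ZMod p) D.word) : ¬ D.IsBipartite := by
  rintro ⟨E, hE, hm⟩
  exact h ((hE.lifts_iff Jet.respects_val).2 (hm.lifts h2))

theorem KnotDiagram.not_isBipartite_of_obstructs {D : KnotDiagram} (p : ℕ) (hp : p.Prime)
    (h2 : (2 : ZMod p) ≠ 0) (f : List (ZMod p)) (x : ZMod p) (m : List (ZMod p)) (μ : ZMod p)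
    (h : Obstructs p D.word f x m μ = true) : ¬ D.IsBipartite :=
  have : Fact p.Prime := ⟨hp⟩
  not_isBipartite h2 (not_lifts_of_obstructs h)

/-- In each certificate the first list gives the Fox colours of the upper strands at the crossings
`0, 1, …`, followed by the colour at the base point. The second list gives the functional at the
crossings, followed by its coefficient at the base point. Mirror images have their own certificates,
since switching the crossings exchanges upper and lower strands. -/
theorem knot9_35_not_isBipartite : ¬ knot9_35.IsBipartite :=
  KnotDiagram.not_isBipartite_of_obstructs 3 (by norm_num) (by decide)
    [0, 1, 0, 1, 0, 2, 0, 0, 2] 1 [0, 2, 1, 0, 0, 1, 2, 0, 0] 0 (by decide +kernel)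

theorem knot9_35_mirror_not_isBipartite : ¬ knot9_35.mirror.IsBipartite :=
  KnotDiagram.not_isBipartite_of_obstructs 3 (by norm_num) (by decide)
    [0, 1, 2, 0, 0, 2, 1, 0, 0] 0 [0, 2, 0, 2, 0, 1, 0, 0, 1] 2 (by decide +kernel)

theorem knot9_37_not_isBipartite : ¬ knot9_37.IsBipartite :=
  KnotDiagram.not_isBipartite_of_obstructs 3 (by norm_num) (by decide)
    [2, 0, 1, 0, 1, 0, 2, 0, 0] 0 [0, 0, 2, 1, 0, 0, 1, 2, 0] 0 (by decide +kernel)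

theorem knot9_37_mirror_not_isBipartite : ¬ knot9_37.mirror.IsBipartite :=
  KnotDiagram.not_isBipartite_of_obstructs 3 (by norm_num) (by decide)
    [2, 1, 2, 0, 0, 1, 0, 0, 0] 0 [1, 1, 0, 0, 1, 2, 1, 1, 2] 1 (by decide +kernel)

theorem knot9_41_not_isBipartite : ¬ knot9_41.IsBipartite :=
  KnotDiagram.not_isBipartite_of_obstructs 7 (by norm_num) (by decide)
    [6, 0, 2, 0, 3, 0, 4, 0, 1] 2 [1, 3, 4, 3, 2, 0, 0, 6, 0] 0 (by decide +kernel)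

theorem knot9_41_mirror_not_isBipartite : ¬ knot9_41.mirror.IsBipartite :=
  KnotDiagram.not_isBipartite_of_obstructs 7 (by norm_num) (by decide)
    [3, 4, 5, 0, 0, 6, 1, 0, 0] 0 [1, 6, 0, 0, 2, 4, 3, 3, 0] 0 (by decide +kernel)

theorem knot9_46_not_isBipartite : ¬ knot9_46.IsBipartite :=
  KnotDiagram.not_isBipartite_of_obstructs 3 (by norm_num) (by decide)
    [1, 0, 0, 1, 0, 2, 2, 0, 0] 0 [2, 2, 1, 2, 1, 2, 0, 2, 0] 1 (by decide +kernel)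

theorem knot9_46_mirror_not_isBipartite : ¬ knot9_46.mirror.IsBipartite :=
  KnotDiagram.not_isBipartite_of_obstructs 3 (by norm_num) (by decide)
    [1, 2, 2, 0, 0, 0, 1, 0, 0] 0 [0, 0, 1, 0, 2, 0, 2, 0, 1] 0 (by decide +kernel)

theorem pretzel33neg3_not_isBipartite : ¬ pretzel33neg3.IsBipartite :=
  KnotDiagram.not_isBipartite_of_obstructs 3 (by norm_num) (by decide)
    [2, 0, 1, 0, 1, 0, 2, 0, 0] 0 [0, 0, 2, 1, 0, 0, 1, 2, 0] 0 (by decide +kernel)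

theorem pretzel33neg3_mirror_not_isBipartite : ¬ pretzel33neg3.mirror.IsBipartite :=
  KnotDiagram.not_isBipartite_of_obstructs 3 (by norm_num) (by decide)
    [0, 1, 2, 0, 2, 1, 0, 0, 0] 0 [2, 2, 0, 0, 2, 1, 2, 1, 2] 1 (by decide +kernel)

theorem knot9_47_not_isBipartite : ¬ knot9_47.IsBipartite :=
  KnotDiagram.not_isBipartite_of_obstructs 3 (by norm_num) (by decide)
    [1, 0, 0, 2, 1, 0, 2, 2, 0] 0 [0, 1, 1, 2, 1, 2, 0, 0, 0] 1 (by decide +kernel)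

theorem knot9_47_mirror_not_isBipartite : ¬ knot9_47.mirror.IsBipartite :=
  KnotDiagram.not_isBipartite_of_obstructs 3 (by norm_num) (by decide)
    [0, 2, 2, 1, 2, 2, 0, 0, 0] 1 [2, 0, 0, 1, 2, 0, 1, 1, 0] 0 (by decide +kernel)

theorem knot9_48_not_isBipartite : ¬ knot9_48.IsBipartite :=
  KnotDiagram.not_isBipartite_of_obstructs 3 (by norm_num) (by decide)
    [1, 0, 0, 1, 0, 2, 2, 0, 0] 0 [1, 2, 1, 2, 1, 0, 0, 2, 0] 0 (by decide +kernel)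

theorem knot9_48_mirror_not_isBipartite : ¬ knot9_48.mirror.IsBipartite :=
  KnotDiagram.not_isBipartite_of_obstructs 3 (by norm_num) (by decide)
    [1, 2, 2, 0, 0, 0, 1, 0, 0] 0 [0, 1, 1, 0, 0, 2, 2, 1, 2] 1 (by decide +kernel)

theorem knot9_49_not_isBipartite : ¬ knot9_49.IsBipartite :=
  KnotDiagram.not_isBipartite_of_obstructs 5 (by norm_num) (by decide)
    [0, 1, 2, 0, 2, 0, 3, 0, 1] 2 [1, 2, 3, 2, 0, 0, 4, 0, 0] 0 (by decide +kernel)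

theorem knot9_49_mirror_not_isBipartite : ¬ knot9_49.mirror.IsBipartite :=
  KnotDiagram.not_isBipartite_of_obstructs 5 (by norm_num) (by decide)
    [2, 3, 3, 0, 4, 4, 0, 0, 0] 0 [1, 0, 0, 4, 0, 3, 2, 2, 0] 0 (by decide +kernel)

theorem knot10_74_not_isBipartite : ¬ knot10_74.IsBipartite :=
  KnotDiagram.not_isBipartite_of_obstructs 3 (by norm_num) (by decide)
    [1, 0, 0, 1, 0, 2, 1, 2, 0, 0] 0 [2, 1, 1, 2, 1, 0, 1, 0, 2, 0] 0 (by decide +kernel)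

theorem knot10_74_mirror_not_isBipartite : ¬ knot10_74.mirror.IsBipartite :=
  KnotDiagram.not_isBipartite_of_obstructs 3 (by norm_num) (by decide)
    [1, 2, 2, 0, 0, 0, 2, 1, 0, 0] 0 [0, 1, 2, 0, 0, 2, 0, 1, 1, 2] 1 (by decide +kernel)

theorem knot10_75_not_isBipartite : ¬ knot10_75.IsBipartite :=
  KnotDiagram.not_isBipartite_of_obstructs 3 (by norm_num) (by decide)
    [1, 1, 0, 0, 2, 0, 0, 2, 0, 0] 0 [0, 2, 1, 0, 1, 2, 0, 1, 2, 0] 0 (by decide +kernel)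

theorem knot10_75_mirror_not_isBipartite : ¬ knot10_75.mirror.IsBipartite :=
  KnotDiagram.not_isBipartite_of_obstructs 3 (by norm_num) (by decide)
    [0, 2, 0, 0, 1, 2, 1, 0, 0, 0] 0 [1, 0, 2, 0, 2, 0, 1, 2, 0, 1] 0 (by decide +kernel)

theorem knot10_103_not_isBipartite : ¬ knot10_103.IsBipartite :=
  KnotDiagram.not_isBipartite_of_obstructs 5 (by norm_num) (by decide)
    [0, 3, 4, 1, 1, 0, 4, 3, 0, 2] 4 [2, 4, 1, 2, 3, 0, 0, 4, 0, 0] 0 (by decide +kernel)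

theorem knot10_103_mirror_not_isBipartite : ¬ knot10_103.mirror.IsBipartite :=
  KnotDiagram.not_isBipartite_of_obstructs 5 (by norm_num) (by decide)
    [3, 1, 4, 3, 2, 0, 0, 1, 0, 0] 0 [0, 2, 1, 4, 4, 0, 1, 2, 0, 3] 1 (by decide +kernel)

theorem knot10_155_not_isBipartite : ¬ knot10_155.IsBipartite :=
  KnotDiagram.not_isBipartite_of_obstructs 5 (by norm_num) (by decide)
    [2, 0, 0, 1, 4, 0, 1, 4, 3, 0] 0 [2, 3, 0, 0, 0, 1, 4, 0, 0, 0] 2 (by decide +kernel)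

theorem knot10_155_mirror_not_isBipartite : ¬ knot10_155.mirror.IsBipartite :=
  KnotDiagram.not_isBipartite_of_obstructs 5 (by norm_num) (by decide)
    [3, 2, 0, 0, 0, 1, 1, 0, 0, 0] 2 [3, 0, 0, 4, 1, 0, 4, 1, 2, 0] 0 (by decide +kernel)

theorem knot10_157_not_isBipartite : ¬ knot10_157.IsBipartite :=
  KnotDiagram.not_isBipartite_of_obstructs 7 (by norm_num) (by decide)
    [1, 0, 2, 0, 2, 0, 0, 4, 0, 1] 2 [2, 3, 4, 3, 4, 0, 0, 0, 6, 0] 0 (by decide +kernel)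

theorem knot10_157_mirror_not_isBipartite : ¬ knot10_157.mirror.IsBipartite :=
  KnotDiagram.not_isBipartite_of_obstructs 7 (by norm_num) (by decide)
    [5, 4, 4, 3, 3, 0, 0, 0, 1, 0] 0 [1, 0, 5, 0, 2, 0, 0, 3, 0, 6] 5 (by decide +kernel)

theorem mainTheorem2 (K : KnotDiagram)
    (hK : K ∈ [knot9_35, knot9_37, knot9_41, knot9_46, pretzel33neg3, knot9_47, knot9_48, knot9_49,
      knot10_74, knot10_75, knot10_103, knot10_155, knot10_157]) :
    ¬ K.IsBipartite ∧ ¬ K.mirror.IsBipartite := by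
  simp only [List.mem_cons, List.not_mem_nil, or_false] at hK
  rcases hK with rfl | rfl | rfl | rfl | rfl | rfl | rfl | rfl | rfl | rfl | rfl | rfl | rfl
  · exact ⟨knot9_35_not_isBipartite, knot9_35_mirror_not_isBipartite⟩
  · exact ⟨knot9_37_not_isBipartite, knot9_37_mirror_not_isBipartite⟩
  · exact ⟨knot9_41_not_isBipartite, knot9_41_mirror_not_isBipartite⟩
  · exact ⟨knot9_46_not_isBipartite, knot9_46_mirror_not_isBipartite⟩
  · exact ⟨pretzel33neg3_not_isBipartite, pretzel33neg3_mirror_not_isBipartite⟩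
  · exact ⟨knot9_47_not_isBipartite, knot9_47_mirror_not_isBipartite⟩
  · exact ⟨knot9_48_not_isBipartite, knot9_48_mirror_not_isBipartite⟩
  · exact ⟨knot9_49_not_isBipartite, knot9_49_mirror_not_isBipartite⟩
  · exact ⟨knot10_74_not_isBipartite, knot10_74_mirror_not_isBipartite⟩
  · exact ⟨knot10_75_not_isBipartite, knot10_75_mirror_not_isBipartite⟩
  · exact ⟨knot10_103_not_isBipartite, knot10_103_mirror_not_isBipartite⟩
  · exact ⟨knot10_155_not_isBipartite, knot10_155_mirror_not_isBipartite⟩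
  · exact ⟨knot10_157_not_isBipartite, knot10_157_mirror_not_isBipartite⟩
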